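/- Let $\mathbb T^3=(\mathbb R/2\pi\mathbb Z)^3\equiv[-\pi,\pi)^3$ with Lebesgue measure $dp$, and let $L^{2,\mathrm e}(\mathbb T^3)$ be the Hilbert space of complex-valued square-integrable functions $f$ on $\mathbb T^3$ with $f(-p)=f(p)$ for almost every $p$. For $\mu_1,\mu_2\in\mathbb R$ and $K\in\mathbb T^3$, represented by $(K_1,K_2,K_3)\in[-\pi,\pi)^3$, let $H_{\mu_1\mu_2}(K)$ be the bounded self-adjoint operator on $L^{2,\mathrm e}(\mathbb T^3)$ given by $$(H_{\mu_1\mu_2}(K)f)(p)=\mathcal E_K(p)f(p)+\frac{\mu_1}{(2\pi)^3}\int_{\mathbb T^3}f(q)\,dq+\frac{2\mu_2}{(2\pi)^3}\sum_{i=1}^3\cos p_i\int_{\mathbb T^3}\cos q_i\,f(q)\,dq,$$ $$\mathcal E_K(p)=4\sum_{i=1}^3\Bigl(1-\cos\tfrac{K_i}{2}\cos p_i\Bigr).$$ Put $$a_{11}=\frac1{8\pi^3}\int_{\mathbb T^3}\frac{dp}{\mathcal E_0(p)},\qquad a=\frac1{8\pi^3}\int_{\mathbb T^3}\frac{(\cos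 p_1-\cos p_2)^2}{\mathcal E_0(p)}\,dp,\qquad \mu_0=\frac{24a_{11}}{12a_{11}-1},\qquad \mu_2^{(0)}=\frac1a,$$ $$\mu_2^-(\mu_1)=\frac{24}{\mu_1+12}-\mu_0\ \ (\mu_1\ne-12),\qquad \mu_2^+(\mu_1)=\frac{24}{\mu_1-12}+\mu_0\ \ (\mu_1\neq 12).$$ Define subsets of the $(\mu_1,\mu_2)$-plane by $$\begin{aligned} \mathcal A_0^-&=\{\mu_1>-12,\ \mu_2>\mu_2^-(\mu_1)\},\qquad \mathcal A_2^-=\{\mu_1<-12,\ \mu_2<\mu_2^-(\mu_1)\},\\ \mathcal A_1^-&=\{\mu_1>-12,\ \mu_2<\mu_2^-(\mu_1)\}\cup\{\mu_1=-12\}\cup\{\mu_1<-12,\ \mu_2>\mu_2^-(\mu_1)\},\\ \mathcal A_0^+&=\{\mu_1<12,\ \mu_2<\mu_2^+(\mu_1)\},\qquad \mathcal A_2^+=\{\mu_1>12,\ \mu_2>\mu_2^+(\mu_1)\},\\ \mathcal A_1^+&=\{\mu_1<12,\ \mu_2>\mu_2^+(\mu_1)\}\cup\{\mu_1=12\}\cup\{\mu_1>12,\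 \mu_2<\mu_2^+(\mu_1)\}, \end{aligned}$$ $$\mathcal D_3^-=\mathcal A_1^-\cap\{(0,\mu_2):\mu_2<-\mu_2^{(0)}\},\qquad \mathcal D_3^+=\mathcal A_1^+\cap\{(0,\mu_2):\mu_2>\mu_2^{(0)}\},$$ $$\mathcal D_0^\mp=\mathcal A_0^\mp,\qquad \mathcal D_1^\mp=\mathcal A_1^\mp\setminus\mathcal D_3^\mp,\qquad \mathcal D_2^\mp=\mathcal A_2^\mp,\qquad \mathcal G_{\alpha\beta}=\mathcal D_\alpha^-\cap\mathcal D_\beta^+ .$$ **Theorem.** Let $\mu_1,\mu_2\in\mathbb R$ and let $\alpha,\beta\in\{0,1,2,3\}$ satisfy $\alpha+\beta<3$ or $(\alpha,\beta)\in\{(3,0),(0,3)\}$. If $(\mu_1,\mu_2)\in\mathcal G_{\alpha\beta}$, then for every $K\in\mathbb T^3$ the operator $H_{\mu_1\mu_2}(K)$ has, counted with multiplicity, at least $\alpha$ eigenvalues (strictly) below and at least $\beta$ eigenvalues (strictly) above its essential spectrum. -/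

import Mathlib

noncomputable section

namespace TwoBoson

open MeasureTheory

/-! ### Generalities: essential spectrum, eigenvalues below and above it -/

section General

variable {X : Type*} [NormedAddCommGroup X] [NormedSpace ℂ X]

/-- The (Fredholm) essential spectrum of a bounded operator: the set of all `z` for which
`T - z` is not a Fredholm operator. For a bounded self-adjoint operator on a Hilbert space this
is the spectrum with the isolated eigenvalues of finite multiplicity removed. -/
def essSpectrum (T : X →L[ℂ] X) : Set ℂ :=
  {z | ¬ (T - z • ContinuousLinearMap.id ℂ X).IsFredholm}

/-- The linear span of all eigenvectors of `T` belonging to real eigenvalues that lie strictly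
below the essential spectrum. -/
def spanBelow (T : X →L[ℂ] X) : Submodule ℂ X :=
  ⨆ z ∈ {z : ℝ | ∀ s : ℝ, (s : ℂ) ∈ essSpectrum T → z < s},
    Module.End.eigenspace (T : X →ₗ[ℂ] X) (z : ℂ)

/-- The linear span of all eigenvectors of `T` belonging to real eigenvalues that lie strictly
above the essential spectrum. -/
def spanAbove (T : X →L[ℂ] X) : Submodule ℂ X :=
  ⨆ z ∈ {z : ℝ | ∀ s : ℝ, (s : ℂ) ∈ essSpectrum T → s < z},
    Module.End.eigenspace (T : X →ₗ[ℂ] X) (z : ℂ)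

/-- `T` has at least `n` eigenvalues, counted with multiplicity, below its essential spectrum.
Eigenspaces of different eigenvalues are linearly independent, so the dimension of their span is
the sum of the multiplicities. -/
def HasAtLeastEigenvaluesBelow (T : X →L[ℂ] X) (n : ℕ) : Prop :=
  (n : Cardinal) ≤ Module.rank ℂ (spanBelow T)

/-- `T` has at least `n` eigenvalues, counted with multiplicity, above its essential spectrum. -/
def HasAtLeastEigenvaluesAbove (T : X →L[ℂ] X) (n : ℕ) : Prop :=
  (n : Cardinal) ≤ Module.rank ℂ (spanAbove T)

end General

/-! ### The torus and the space of even square-integrable functions -/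

/-- The fundamental domain `[-π, π)³` of the torus `(ℝ / 2πℤ)³`. -/
def torus : Set (Fin 3 → ℝ) := Set.univ.pi fun _ => Set.Ico (-Real.pi) Real.pi

/-- Lebesgue measure `dp` on the torus. -/
def torusMeasure : Measure (Fin 3 → ℝ) := (volume : Measure (Fin 3 → ℝ)).restrict torus

/-- `L²(𝕋³)`. -/
abbrev L2 : Type := Lp ℂ 2 torusMeasure

theorem torus_subset_Icc :
    torus ⊆ Set.Icc (fun _ => -Real.pi) (fun _ => Real.pi) := by
  intro p hp
  exact ⟨fun i => (hp i trivial).1, fun i => (hp i trivial).2.le⟩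

instance : IsFiniteMeasure torusMeasure := by
  refine ⟨?_⟩
  rw [torusMeasure, Measure.restrict_apply_univ]
  exact (measure_mono torus_subset_Icc).trans_lt measure_Icc_lt_top

theorem torusMeasure_eq :
    torusMeasure = (volume : Measure (Fin 3 → ℝ)).restrict
      (Set.Icc (fun _ => -Real.pi) (fun _ => Real.pi)) := by
  have h : torus =ᵐ[(volume : Measure (Fin 3 → ℝ))]
      Set.Icc (fun _ => -Real.pi) (fun _ => Real.pi) :=
    Measure.univ_pi_Ico_ae_eq_Icc
  exact Measure.restrict_congr_set h

/-- The reflection `p ↦ -p` preserves the measure of the torus. -/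
theorem measurePreserving_neg : MeasurePreserving (fun p : Fin 3 → ℝ => -p)
    torusMeasure torusMeasure := by
  have h := (Measure.measurePreserving_neg (volume : Measure (Fin 3 → ℝ))).restrict_preimage
    (s := Set.Icc (fun _ => -Real.pi) (fun _ => Real.pi)) measurableSet_Icc
  have h2 : Neg.neg ⁻¹' (Set.Icc (fun _ : Fin 3 => -Real.pi) (fun _ => Real.pi)) =
      Set.Icc (fun _ => -Real.pi) (fun _ => Real.pi) := by
    ext p
    simp only [Set.mem_preimage, Set.mem_Icc, Pi.le_def, Pi.neg_apply]
    constructor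
    · rintro ⟨h1, h2⟩
      exact ⟨fun i => by linarith [h2 i], fun i => by linarith [h1 i]⟩
    · rintro ⟨h1, h2⟩
      exact ⟨fun i => by linarith [h2 i], fun i => by linarith [h1 i]⟩
  rw [torusMeasure_eq]
  rw [h2] at h
  exact h

/-- `L^{2,e}(𝕋³)`: the subspace of even functions, `f (-p) = f p` for almost every `p`. -/
def evenL2 : Submodule ℂ L2 where
  carrier := {f | ∀ᵐ p ∂torusMeasure, f (-p) = f p}
  zero_mem' := by
    have h := Lp.coeFn_zero ℂ 2 torusMeasure
    have h' := measurePreserving_neg.quasiMeasurePreserving.ae h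
    filter_upwards [h, h'] with p h1 h2
    simp only [Pi.zero_apply] at h1 h2
    rw [h1, h2]
  add_mem' := by
    intro f g hf hg
    change ∀ᵐ p ∂torusMeasure, f (-p) = f p at hf
    change ∀ᵐ p ∂torusMeasure, g (-p) = g p at hg
    change ∀ᵐ p ∂torusMeasure, (f + g : L2) (-p) = (f + g : L2) p
    have h := Lp.coeFn_add f g
    have h' := measurePreserving_neg.quasiMeasurePreserving.ae h
    filter_upwards [h, h', hf, hg] with p h1 h2 h3 h4
    rw [h1, h2, Pi.add_apply, Pi.add_apply, h3, h4]
  smul_mem' := by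
    intro c f hf
    change ∀ᵐ p ∂torusMeasure, f (-p) = f p at hf
    change ∀ᵐ p ∂torusMeasure, (c • f : L2) (-p) = (c • f : L2) p
    have h := Lp.coeFn_smul c f
    have h' := measurePreserving_neg.quasiMeasurePreserving.ae h
    filter_upwards [h, h', hf] with p h1 h2 h3
    rw [h1, h2, Pi.smul_apply, Pi.smul_apply, h3]

theorem mem_evenL2 {f : L2} : f ∈ evenL2 ↔ ∀ᵐ p ∂torusMeasure, f (-p) = f p := Iff.rfl

/-! ### The operators -/

/-- A bounded continuous real function is an element of every `L^q(𝕋³)`. -/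
theorem memLp_ofReal {φ : (Fin 3 → ℝ) → ℝ} (hφ : Continuous φ) {C : ℝ} (hC : ∀ p, |φ p| ≤ C)
    (q : ENNReal) : MemLp (fun p => (φ p : ℂ)) q torusMeasure :=
  MemLp.of_bound (Complex.continuous_ofReal.comp hφ).aestronglyMeasurable C
    (Filter.Eventually.of_forall fun p => by simpa using hC p)

/-- Multiplication by a bounded continuous real function, as a bounded operator on `L²(𝕋³)`. -/
def mulOp (φ : (Fin 3 → ℝ) → ℝ) (hφ : Continuous φ) (C : ℝ) (hC : ∀ p, |φ p| ≤ C) : L2 →L[ℂ] L2 :=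
  (ContinuousLinearMap.mul ℂ ℂ).holderL torusMeasure ⊤ 2 2 ((memLp_ofReal hφ hC ⊤).toLp _)

theorem mulOp_apply {φ : (Fin 3 → ℝ) → ℝ} (hφ : Continuous φ) {C : ℝ} (hC : ∀ p, |φ p| ≤ C)
    (f : L2) : ∀ᵐ p ∂torusMeasure, mulOp φ hφ C hC f p = φ p * f p := by
  have h1 := (ContinuousLinearMap.mul ℂ ℂ).coeFn_holder (r := 2)
    ((memLp_ofReal hφ hC ⊤).toLp _) f
  have h2 := (memLp_ofReal hφ hC ⊤).coeFn_toLp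
  filter_upwards [h1, h2] with p hp1 hp2
  have h3 : mulOp φ hφ C hC f p =
      (ContinuousLinearMap.mul ℂ ℂ) (((memLp_ofReal hφ hC ⊤).toLp _ : Lp ℂ ⊤ torusMeasure) p)
        (f p) := hp1
  rw [h3, hp2]
  rfl

/-- The rank-one integral operator `f ↦ φ(·) ∫ φ(q) f(q) dq` on `L²(𝕋³)`. -/
def rankOne (φ : (Fin 3 → ℝ) → ℝ) (hφ : Continuous φ) (C : ℝ) (hC : ∀ p, |φ p| ≤ C) :
    L2 →L[ℂ] L2 :=
  (innerSL ℂ ((memLp_ofReal hφ hC 2).toLp _)).smulRight ((memLp_ofReal hφ hC 2).toLp _)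

theorem rankOne_apply {φ : (Fin 3 → ℝ) → ℝ} (hφ : Continuous φ) {C : ℝ} (hC : ∀ p, |φ p| ≤ C)
    (f : L2) : ∀ᵐ p ∂torusMeasure,
      rankOne φ hφ C hC f p = φ p * ∫ q, (φ q : ℂ) * f q ∂torusMeasure := by
  have h2 := (memLp_ofReal hφ hC 2).coeFn_toLp
  have h3 : inner ℂ ((memLp_ofReal hφ hC 2).toLp _ : L2) f
      = ∫ q, (φ q : ℂ) * f q ∂torusMeasure := by
    rw [L2.inner_def]
    refine integral_congr_ae ?_
    filter_upwards [h2] with q hq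
    rw [hq]
    simp [mul_comm]
  have h4 := Lp.coeFn_smul (inner ℂ ((memLp_ofReal hφ hC 2).toLp _ : L2) f)
    ((memLp_ofReal hφ hC 2).toLp _ : L2)
  filter_upwards [h2, h4] with p hp2 hp4
  have h5 : rankOne φ hφ C hC f p = (inner ℂ ((memLp_ofReal hφ hC 2).toLp _ : L2) f •
    ((memLp_ofReal hφ hC 2).toLp _ : L2) : L2) p := rfl
  rw [h5, hp4, Pi.smul_apply, hp2, h3, smul_eq_mul, mul_comm]

/-- The dispersion function `𝓔_K(p) = 4 ∑ᵢ (1 - cos(Kᵢ/2) cos pᵢ)`. -/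
def dispersion (K p : Fin 3 → ℝ) : ℝ := 4 * ∑ i, (1 - Real.cos (K i / 2) * Real.cos (p i))

theorem continuous_dispersion (K : Fin 3 → ℝ) : Continuous (dispersion K) := by
  unfold dispersion
  fun_prop

theorem abs_dispersion_le (K p : Fin 3 → ℝ) : |dispersion K p| ≤ 24 := by
  have h : ∀ i, |Real.cos (K i / 2) * Real.cos (p i)| ≤ 1 := fun i => by
    rw [abs_mul]
    exact mul_le_one₀ (Real.abs_cos_le_one _) (abs_nonneg _) (Real.abs_cos_le_one _)
  have h0 := abs_le.1 (h 0)
  have h1 := abs_le.1 (h 1)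
  have h2 := abs_le.1 (h 2)
  rw [dispersion, Fin.sum_univ_three, abs_le]
  constructor <;> linarith [h0.1, h0.2, h1.1, h1.2, h2.1, h2.2]

/-- The free operator `H₀(K)`, on all of `L²(𝕋³)`. -/
def freeOp (K : Fin 3 → ℝ) : L2 →L[ℂ] L2 :=
  mulOp (dispersion K) (continuous_dispersion K) 24 (abs_dispersion_le K)

theorem continuous_cosCoord (i : Fin 3) : Continuous fun p : Fin 3 → ℝ => Real.cos (p i) := by
  fun_prop

/-- The interaction
`(V f)(p) = μ₁/(2π)³ ∫ f(q) dq + 2μ₂/(2π)³ ∑ᵢ cos pᵢ ∫ cos qᵢ f(q) dq`, on all of `L²(𝕋³)`. -/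
def interaction (μ₁ μ₂ : ℝ) : L2 →L[ℂ] L2 :=
  ((μ₁ / (2 * Real.pi) ^ 3 : ℝ) : ℂ) •
      rankOne (fun _ => 1) continuous_const 1 (fun _ => by simp) +
    ((2 * μ₂ / (2 * Real.pi) ^ 3 : ℝ) : ℂ) •
      ∑ i : Fin 3, rankOne (fun p => Real.cos (p i)) (continuous_cosCoord i) 1
        (fun p => Real.abs_cos_le_one (p i))

theorem fullHamiltonian_apply (μ₁ μ₂ : ℝ) (K : Fin 3 → ℝ) (f : L2) :
    ∀ᵐ p ∂torusMeasure, (freeOp K + interaction μ₁ μ₂) f p =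
      dispersion K p * f p + ((μ₁ / (2 * Real.pi) ^ 3 : ℝ) : ℂ) * ∫ q, f q ∂torusMeasure +
        ((2 * μ₂ / (2 * Real.pi) ^ 3 : ℝ) : ℂ) * ∑ i : Fin 3,
          (Real.cos (p i) : ℂ) * ∫ q, (Real.cos (q i) : ℂ) * f q ∂torusMeasure := by
  let R0 : L2 →L[ℂ] L2 := rankOne (fun _ => 1) continuous_const 1 (fun _ => by simp)
  let R : Fin 3 → L2 →L[ℂ] L2 := fun i => rankOne (fun p => Real.cos (p i))
    (continuous_cosCoord i) 1 (fun p => Real.abs_cos_le_one (p i))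
  let c₁ : ℂ := ((μ₁ / (2 * Real.pi) ^ 3 : ℝ) : ℂ)
  let c₂ : ℂ := ((2 * μ₂ / (2 * Real.pi) ^ 3 : ℝ) : ℂ)
  have e : (freeOp K + interaction μ₁ μ₂) f =
      freeOp K f + (c₁ • R0 f + c₂ • (R 0 f + R 1 f + R 2 f)) := by
    rw [interaction, Fin.sum_univ_three]
    rfl
  have hF := mulOp_apply (continuous_dispersion K) (abs_dispersion_le K) f
  have h0 : ∀ᵐ p ∂torusMeasure, R0 f p = _ :=
    rankOne_apply (φ := fun _ => 1) continuous_const (C := 1) (fun _ => by simp) f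
  have hR : ∀ i, ∀ᵐ p ∂torusMeasure, R i f p = _ := fun i =>
    rankOne_apply (continuous_cosCoord i) (fun p => Real.abs_cos_le_one (p i)) f
  rw [e]
  filter_upwards [hF, h0, hR 0, hR 1, hR 2, Lp.coeFn_add (freeOp K f)
      (c₁ • R0 f + c₂ • (R 0 f + R 1 f + R 2 f)),
    Lp.coeFn_add (c₁ • R0 f) (c₂ • (R 0 f + R 1 f + R 2 f)), Lp.coeFn_smul c₁ (R0 f),
    Lp.coeFn_smul c₂ (R 0 f + R 1 f + R 2 f), Lp.coeFn_add (R 0 f + R 1 f) (R 2 f),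
    Lp.coeFn_add (R 0 f) (R 1 f)] with p a1 a2 a3 a4 a5 a6 a7 a8 a9 a10 a11
  rw [a6, Pi.add_apply, a7, Pi.add_apply, a8, Pi.smul_apply, a9, Pi.smul_apply, a10,
    Pi.add_apply, a11, Pi.add_apply, a2, a3, a4, a5, Fin.sum_univ_three]
  have a1' : freeOp K f p = dispersion K p * f p := a1
  rw [a1']
  simp only [Complex.ofReal_one, one_mul, smul_eq_mul]
  ring

theorem fullHamiltonian_mem (μ₁ μ₂ : ℝ) (K : Fin 3 → ℝ) :
    ∀ f ∈ evenL2, (freeOp K + interaction μ₁ μ₂) f ∈ evenL2 := by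
  intro f hf
  have h := fullHamiltonian_apply μ₁ μ₂ K f
  have h' := measurePreserving_neg.quasiMeasurePreserving.ae h
  rw [mem_evenL2] at hf ⊢
  filter_upwards [h, h', hf] with p h1 h2 h3
  rw [h1, h2, h3]
  simp only [dispersion, Pi.neg_apply, Real.cos_neg]

/-- The two-boson lattice Schrödinger operator `H_{μ₁μ₂}(K) = H₀(K) + V_{μ₁μ₂}` acting on
`L^{2,e}(𝕋³)`. -/
def hamiltonian (μ₁ μ₂ : ℝ) (K : Fin 3 → ℝ) : evenL2 →L[ℂ] evenL2 :=
  (freeOp K + interaction μ₁ μ₂).restrict (fullHamiltonian_mem μ₁ μ₂ K)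

/-! ### The regions of the coupling plane -/

/-- `a₁₁ˢ(0) = ∫ α₁ˢ(p)² / 𝓔₀(p) dp` with `α₁ˢ = 1/√(8π³)`. -/
def a11 : ℝ :=
  ∫ p, (1 / Real.sqrt (8 * Real.pi ^ 3)) ^ 2 / dispersion 0 p ∂torusMeasure

/-- `a^{a₁₂}(0) = ∫ α₃^{a₁₂}(p)² / 𝓔₀(p) dp` with `α₃^{a₁₂}(p) = (cos p₁ - cos p₂)/√(8π³)`. -/
def aA12 : ℝ :=
  ∫ p, ((Real.cos (p 0) - Real.cos (p 1)) / Real.sqrt (8 * Real.pi ^ 3)) ^ 2 / dispersion 0 p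
    ∂torusMeasure

/-- `μ₀ = 24 a₁₁ˢ(0) / (12 a₁₁ˢ(0) - 1)`. -/
def mu0 : ℝ := 24 * a11 / (12 * a11 - 1)

/-- `μ₂⁽⁰⁾ = 1 / a^{a₁₂}(0)`. -/
def mu2crit : ℝ := 1 / aA12

/-- `μ₂⁻(μ₁) = 24/(μ₁ + 12) - μ₀`, used only for `μ₁ ≠ -12`. -/
def mu2Minus (μ₁ : ℝ) : ℝ := 24 / (μ₁ + 12) - mu0

/-- `μ₂⁺(μ₁) = 24/(μ₁ - 12) + μ₀`, used only for `μ₁ ≠ 12`. -/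
def mu2Plus (μ₁ : ℝ) : ℝ := 24 / (μ₁ - 12) + mu0

/-- The regions `𝒜⁻_ζ`, `ζ = 0, 1, 2`. -/
def AMinus : ℕ → Set (ℝ × ℝ)
  | 0 => {m | -12 < m.1 ∧ mu2Minus m.1 < m.2}
  | 1 => {m | -12 < m.1 ∧ m.2 < mu2Minus m.1} ∪ {m | m.1 = -12} ∪
      {m | m.1 < -12 ∧ mu2Minus m.1 < m.2}
  | 2 => {m | m.1 < -12 ∧ m.2 < mu2Minus m.1}
  | _ => ∅

/-- The regions `𝒜⁺_ζ`, `ζ = 0, 1, 2`. -/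
def APlus : ℕ → Set (ℝ × ℝ)
  | 0 => {m | m.1 < 12 ∧ m.2 < mu2Plus m.1}
  | 1 => {m | m.1 < 12 ∧ mu2Plus m.1 < m.2} ∪ {m | m.1 = 12} ∪
      {m | 12 < m.1 ∧ m.2 < mu2Plus m.1}
  | 2 => {m | 12 < m.1 ∧ mu2Plus m.1 < m.2}
  | _ => ∅

/-- The interval `ℬ⁻₁ = (-∞, -μ₂⁽⁰⁾)`. -/
def BMinus1 : Set ℝ := {x | x < -mu2crit}

/-- The interval `ℬ⁺₁ = (μ₂⁽⁰⁾, ∞)`. -/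
def BPlus1 : Set ℝ := {x | mu2crit < x}

/-- The region `𝒟⁻₃ = 𝒜⁻₁ ∩ {(0, μ₂) : μ₂ ∈ ℬ⁻₁}`. -/
def DMinus3 : Set (ℝ × ℝ) := AMinus 1 ∩ {m | m.1 = 0 ∧ m.2 ∈ BMinus1}

/-- The region `𝒟⁺₃ = 𝒜⁺₁ ∩ {(0, μ₂) : μ₂ ∈ ℬ⁺₁}`. -/
def DPlus3 : Set (ℝ × ℝ) := APlus 1 ∩ {m | m.1 = 0 ∧ m.2 ∈ BPlus1}

/-- The regions `𝒟⁻_ζ`, `ζ = 0, 1, 2, 3`. -/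
def DMinus : ℕ → Set (ℝ × ℝ)
  | 0 => AMinus 0
  | 1 => AMinus 1 \ DMinus3
  | 2 => AMinus 2
  | 3 => DMinus3
  | _ => ∅

/-- The regions `𝒟⁺_ζ`, `ζ = 0, 1, 2, 3`. -/
def DPlus : ℕ → Set (ℝ × ℝ)
  | 0 => APlus 0
  | 1 => APlus 1 \ DPlus3
  | 2 => APlus 2
  | 3 => DPlus3
  | _ => ∅

/-- `𝒢_{αβ} = 𝒟⁻_α ∩ 𝒟⁺_β`. -/
def G (α β : ℕ) : Set (ℝ × ℝ) := DMinus α ∩ DPlus β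

end TwoBoson

end

noncomputable section

namespace TwoBoson

open MeasureTheory Filter Topology
open scoped LinearMap.FiniteRangeSetoid

/-! ### The variational principle for finite-rank perturbations -/

section Abstract

variable {X : Type*} [NormedAddCommGroup X] [InnerProductSpace ℂ X]

/-! The proof is variational and reduces everything to zero quasimomentum. With `σ = 1` for the
lower edge and `σ = -1` for the upper one, the operator `σ • hamiltonian μ₁ μ₂ K` is a finite-rank
perturbation of a multiplication operator bounded below by `m = 12σ - 4 ∑ cos (Kᵢ/2)`. A form lying
below `m` on an `n`-dimensional space therefore yields `n` eigenvalues below the essential spectrum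
(`hasAtLeastEigenvaluesBelow_of_form_lt`).

The dependence on `K` disappears because `σ𝓔_K - m = 4 ∑ cos (Kᵢ/2) (1 - σ cos pᵢ)` and `0 ≤ cos
(Kᵢ/2) ≤ 1`. The form at `K`, measured from `m`, is at most the form at `K = 0` measured from its
edge (`re_inner_hamiltonian_sub_le`), so trial functions that work at `K = 0` work for every `K`.
Translation of the momenta by `π` exchanges the two edges, so with couplings `ν = σμ` both signs
have the same form bounds.

At the edge the natural trial functions involve `1/𝓔`, which is integrable in dimension three but
not square-integrable; it is replaced by `1/(𝓔 + ε)`, and `ε → 0` by dominated convergence. On the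
family `x + 1/(𝓔 + ε)` the limiting bound is a quadratic polynomial in `x` whose critical value is a
positive multiple of `ν₂ - mu2Minus ν₁` (`affBound_zero_crit`). This gives one negative direction in
`AMinus 1`. In `AMinus 2` the constant function is a second one, made form-orthogonal to the first
by the choice of `x`. In `DMinus3` two more come from `cos p₁ - cos p₂` and `cos p₁ + cos p₂ - 2 cos
p₃` divided by `𝓔 + ε`. Permutation symmetry makes them form-orthogonal to each other and to the
symmetric function, and the condition `1 + ν₂ a < 0` makes them negative (`meanForm_diffTrial`). -/

theorem isUnit_sub_smul_of_lt [CompleteSpace X] {M : X →L[ℂ] X} {m s : ℝ} (hs : s < m)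
    (hM : ∀ x, m * ‖x‖ ^ 2 ≤ (inner ℂ (M x) x).re) :
    IsUnit (M - (s : ℂ) • ContinuousLinearMap.id ℂ X) := by
  refine ContinuousLinearMap.isUnit_of_forall_le_norm_inner_map _ (c := ⟨m - s, by linarith⟩)
    (by change 0 < m - s; linarith) fun x => ?_
  refine le_trans ?_ (Complex.re_le_norm _)
  have h : (inner ℂ ((M - (s : ℂ) • ContinuousLinearMap.id ℂ X) x) x).re
      = (inner ℂ (M x) x).re - s * ‖x‖ ^ 2 := by
    simp only [sub_apply, smul_apply,
      ContinuousLinearMap.id_apply, inner_sub_left, inner_smul_left, Complex.conj_ofReal,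
      Complex.sub_re, Complex.re_ofReal_mul]
    rw [← inner_self_eq_norm_sq (𝕜 := ℂ) x]
    rfl
  rw [h]
  change ‖x‖ ^ 2 * (m - s) ≤ _
  linarith [hM x]

/-- Being Fredholm is insensitive to finite-rank changes: `M - s` is invertible by coercivity, and
its inverse is a quasi-inverse of `T - s`. -/
theorem notMem_essSpectrum_of_lt [CompleteSpace X] {T M : X →L[ℂ] X}
    (hV : (T - M : X →L[ℂ] X).toLinearMap.HasFiniteRange) {m s : ℝ} (hs : s < m)
    (hM : ∀ x, m * ‖x‖ ^ 2 ≤ (inner ℂ (M x) x).re) : (s : ℂ) ∉ essSpectrum T := by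
  obtain ⟨u, hu⟩ := isUnit_sub_smul_of_lt hs hM
  simp only [essSpectrum, Set.mem_ofPred_eq, not_not]
  refine ContinuousLinearMap.IsFredholm.of_isQuasiInverse (v := (↑u⁻¹ : X →L[ℂ] X)) ?_
  have h1 : (↑u⁻¹ : X →L[ℂ] X).toLinearMap.IsQuasiInverse (↑u : X →L[ℂ] X).toLinearMap :=
    (ContinuousLinearEquiv.unitsEquiv ℂ X u).toLinearEquiv.isQuasiInverse
  refine (LinearMap.isQuasiInverse_congr (Setoid.refl _) ?_).1 h1
  rw [LinearMap.FiniteRangeSetoid.equiv_iff_hasFiniteRange, hu]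
  have h2 : (T - (s : ℂ) • ContinuousLinearMap.id ℂ X).toLinearMap -
      (M - (s : ℂ) • ContinuousLinearMap.id ℂ X).toLinearMap = (T - M).toLinearMap := by
    ext x
    simp
  rwa [h2]

/-- A Cauchy–Schwarz estimate for a nonnegative form, obtained by testing positivity at `x - t B x`.
It turns a minimizing sequence for the form into a sequence of approximate eigenvectors. -/
theorem norm_sq_apply_le_of_nonneg_on {B : X →L[ℂ] X} (hB : (B : X →ₗ[ℂ] X).IsSymmetric)
    {S : Submodule ℂ X} (hS : ∀ x ∈ S, B x ∈ S) (hpos : ∀ x ∈ S, 0 ≤ (inner ℂ (B x) x).re)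
    {x : X} (hx : x ∈ S) : ‖B x‖ ^ 2 ≤ (‖B‖ + 1) * (inner ℂ (B x) x).re := by
  have hn : 0 < ‖B‖ + 1 := by positivity
  -- The summand `1` keeps the inverse meaningful when `B = 0`.
  set t : ℝ := (‖B‖ + 1)⁻¹ with ht
  have ht0 : 0 < t := inv_pos.2 hn
  have h := hpos (x - (t : ℂ) • B x) (S.sub_mem hx (S.smul_mem _ (hS x hx)))
  have e1 : inner ℂ (B (B x)) x = inner ℂ (B x) (B x) := hB (B x) x
  have e : (inner ℂ (B (x - (t : ℂ) • B x)) (x - (t : ℂ) • B x)).re =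
      (inner ℂ (B x) x).re - 2 * t * ‖B x‖ ^ 2 + t ^ 2 * (inner ℂ (B (B x)) (B x)).re := by
    have e2 : (inner ℂ (B x) (B x)).re = ‖B x‖ ^ 2 := inner_self_eq_norm_sq (𝕜 := ℂ) (B x)
    simp only [map_sub, map_smul, inner_sub_left, inner_sub_right, inner_smul_left,
      inner_smul_right, Complex.conj_ofReal, Complex.sub_re, Complex.re_ofReal_mul, e1, e2]
    ring
  rw [e] at h
  have h3 : (inner ℂ (B (B x)) (B x)).re ≤ ‖B‖ * ‖B x‖ ^ 2 := by
    calc (inner ℂ (B (B x)) (B x)).re ≤ ‖inner ℂ (B (B x)) (B x)‖ := Complex.re_le_norm _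
      _ ≤ ‖B (B x)‖ * ‖B x‖ := norm_inner_le_norm _ _
      _ ≤ (‖B‖ * ‖B x‖) * ‖B x‖ := by gcongr; exact B.le_opNorm _
      _ = _ := by ring
  have h4 : t * (‖B‖ + 1) = 1 := inv_mul_cancel₀ hn.ne'
  have h5 : t ^ 2 * (inner ℂ (B (B x)) (B x)).re ≤ t ^ 2 * (‖B‖ * ‖B x‖ ^ 2) := by gcongr
  have h6 : t ^ 2 * (‖B‖ * ‖B x‖ ^ 2) = t * ‖B x‖ ^ 2 - t ^ 2 * ‖B x‖ ^ 2 := by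
    linear_combination t * ‖B x‖ ^ 2 * h4
  have h7 : t * ‖B x‖ ^ 2 ≤ (inner ℂ (B x) x).re := by
    nlinarith [mul_nonneg (sq_nonneg t) (sq_nonneg ‖B x‖)]
  calc ‖B x‖ ^ 2 = (‖B‖ + 1) * (t * ‖B x‖ ^ 2) := by rw [← mul_assoc, mul_comm _ t, h4, one_mul]
    _ ≤ _ := by gcongr

/-- On an invariant closed subspace where the quadratic form of `T` takes a value below the
threshold `m`, the operator `T` has an eigenvalue below `m`. -/
theorem exists_eigenvector_of_form_lt [CompleteSpace X] {T M : X →L[ℂ] X}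
    (hT : (T : X →ₗ[ℂ] X).IsSymmetric)
    (hV : (T - M : X →L[ℂ] X).toLinearMap.HasFiniteRange) {m : ℝ}
    (hM : ∀ x, m * ‖x‖ ^ 2 ≤ (inner ℂ (M x) x).re)
    {S : Submodule ℂ X} (hSc : IsClosed (S : Set X)) (hS : ∀ x ∈ S, T x ∈ S)
    {w : X} (hw : w ∈ S) (hlt : (inner ℂ (T w) w).re < m * ‖w‖ ^ 2) :
    ∃ l : ℝ, l < m ∧ ∃ x ∈ S, x ≠ 0 ∧ T x = (l : ℂ) • x := by
  set Q : Set ℝ := {r | ∃ x ∈ S, ‖x‖ = 1 ∧ r = (inner ℂ (T x) x).re} with hQ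
  have hbdd : BddBelow Q := by
    refine ⟨-‖T‖, ?_⟩
    rintro r ⟨x, -, hx1, rfl⟩
    have := Complex.abs_re_le_norm (inner ℂ (T x) x)
    have h2 : ‖inner ℂ (T x) x‖ ≤ ‖T x‖ * ‖x‖ := norm_inner_le_norm _ _
    have h3 := T.le_opNorm x
    rw [hx1] at h2 h3
    linarith [neg_abs_le (inner ℂ (T x) x).re]
  have hform : ∀ (c : ℝ) (x : X), (inner ℂ (T ((c : ℂ) • x)) ((c : ℂ) • x)).re =
      c ^ 2 * (inner ℂ (T x) x).re := by
    intro c x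
    simp only [map_smul, inner_smul_left, inner_smul_right, Complex.conj_ofReal,
      Complex.re_ofReal_mul]
    ring
  have hnorm : ∀ x ∈ S, x ≠ 0 → (inner ℂ (T x) x).re / ‖x‖ ^ 2 ∈ Q := by
    intro x hx hx0
    have hx0' : ‖x‖ ≠ 0 := norm_ne_zero_iff.2 hx0
    refine ⟨((‖x‖⁻¹ : ℝ) : ℂ) • x, S.smul_mem _ hx, ?_, ?_⟩
    · rw [norm_smul, Complex.norm_real, norm_inv, norm_norm, inv_mul_cancel₀ hx0']
    · rw [hform]
      field_simp
  have hw0 : w ≠ 0 := by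
    rintro rfl
    simp at hlt
  have hw0' : 0 < ‖w‖ := norm_pos_iff.2 hw0
  have hne : Q.Nonempty := ⟨_, hnorm w hw hw0⟩
  set l := sInf Q with hl
  have hlm : l < m := by
    refine (csInf_le hbdd (hnorm w hw hw0)).trans_lt ?_
    rw [div_lt_iff₀ (by positivity)]
    exact hlt
  have hlow : ∀ x ∈ S, l * ‖x‖ ^ 2 ≤ (inner ℂ (T x) x).re := by
    intro x hx
    by_cases hx0 : x = 0
    · simp [hx0]
    · have := csInf_le hbdd (hnorm x hx hx0)
      rwa [le_div_iff₀ (by have := norm_pos_iff.2 hx0; positivity)] at this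
  set B : X →L[ℂ] X := T - (l : ℂ) • ContinuousLinearMap.id ℂ X with hB
  have hBx : ∀ x, B x = T x - (l : ℂ) • x := fun x => by simp [hB]
  have hBform : ∀ x, (inner ℂ (B x) x).re = (inner ℂ (T x) x).re - l * ‖x‖ ^ 2 := by
    intro x
    have e2 : (inner ℂ x x).re = ‖x‖ ^ 2 := inner_self_eq_norm_sq (𝕜 := ℂ) x
    simp only [hBx, inner_sub_left, inner_smul_left, Complex.conj_ofReal, Complex.sub_re,
      Complex.re_ofReal_mul, e2]
  have hBsymm : (B : X →ₗ[ℂ] X).IsSymmetric := by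
    intro x y
    have h : inner ℂ (T x) y = inner ℂ x (T y) := hT x y
    change inner ℂ (B x) y = inner ℂ x (B y)
    simp only [hBx, inner_sub_left, inner_sub_right, inner_smul_left, inner_smul_right,
      Complex.conj_ofReal, h]
  have hBS : ∀ x ∈ S, B x ∈ S := fun x hx => by
    rw [hBx]
    exact S.sub_mem (hS x hx) (S.smul_mem _ hx)
  have hBpos : ∀ x ∈ S, 0 ≤ (inner ℂ (B x) x).re := fun x hx => by
    rw [hBform]
    linarith [hlow x hx]
  -- The candidate eigenvalue `l` is the infimum of the Rayleigh quotient on `S`. Along a minimizing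
  -- sequence of unit vectors the form of `B = T - l` tends to zero, hence so does `B u`.
  obtain ⟨r, -, hr, hrQ⟩ := exists_seq_tendsto_sInf hne hbdd
  choose u huS hu1 hur using hrQ
  have hBu : Tendsto (fun n => B (u n)) atTop (𝓝 0) := by
    have h1 : Tendsto (fun n => (‖B‖ + 1) * (inner ℂ (B (u n)) (u n)).re) atTop (𝓝 0) := by
      have : Tendsto (fun n => (‖B‖ + 1) * (r n - l)) atTop (𝓝 ((‖B‖ + 1) * (l - l))) :=
        (hr.sub_const l).const_mul _
      rw [sub_self, mul_zero] at this
      refine this.congr fun n => ?_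
      rw [hBform, hu1, ← hur]
      ring
    have h2 : Tendsto (fun n => ‖B (u n)‖ ^ 2) atTop (𝓝 0) :=
      squeeze_zero (fun n => by positivity)
        (fun n => norm_sq_apply_le_of_nonneg_on hBsymm hBS hBpos (huS n)) h1
    have h3 := h2.sqrt
    simp only [Real.sqrt_zero, Real.sqrt_sq (norm_nonneg _)] at h3
    exact tendsto_zero_iff_norm_tendsto_zero.2 h3
  -- Compactness comes from writing `u = (M - l)⁻¹ (B u - (T - M) u)`: the first term tends to zero,
  -- and the second stays bounded in a finite-dimensional space, so it converges along a
  -- subsequence.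
  obtain ⟨N, hN⟩ := isUnit_sub_smul_of_lt hlm hM
  have hNinv : ∀ x, (↑N⁻¹ : X →L[ℂ] X) (M x - (l : ℂ) • x) = x := by
    intro x
    have h : (↑N⁻¹ * ↑N : X →L[ℂ] X) x = x := by rw [N.inv_mul]; rfl
    rw [hN] at h
    simpa using h
  have : FiniteDimensional ℂ (T - M).toLinearMap.range := Module.Finite.of_fg hV
  have : ProperSpace (T - M).toLinearMap.range := FiniteDimensional.proper ℂ _
  let g : ℕ → (T - M).toLinearMap.range := fun n => ⟨(T - M) (u n), ⟨u n, rfl⟩⟩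
  have hg : ∀ n, g n ∈ Metric.closedBall (0 : (T - M).toLinearMap.range) ‖T - M‖ := by
    intro n
    rw [mem_closedBall_zero_iff]
    change ‖(T - M) (u n)‖ ≤ _
    simpa [hu1 n] using (T - M).le_opNorm (u n)
  obtain ⟨g₀, -, φ, hφ, hlim⟩ := (isCompact_closedBall (0 : (T - M).toLinearMap.range)
    ‖T - M‖).tendsto_subseq hg
  have hlim' : Tendsto (fun n => (T - M) (u (φ n))) atTop (𝓝 (g₀ : X)) :=
    (continuous_subtype_val.tendsto g₀).comp hlim
  have hMu : Tendsto (fun n => M (u (φ n)) - (l : ℂ) • u (φ n)) atTop (𝓝 (0 - (g₀ : X))) := by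
    refine ((hBu.comp hφ.tendsto_atTop).sub hlim').congr fun n => ?_
    simp only [Function.comp, hBx, sub_apply]
    abel
  have hu : Tendsto (fun n => u (φ n)) atTop (𝓝 ((↑N⁻¹ : X →L[ℂ] X) (0 - (g₀ : X)))) := by
    refine (((↑N⁻¹ : X →L[ℂ] X).continuous.tendsto _).comp hMu).congr fun n => ?_
    exact hNinv _
  set f : X := (↑N⁻¹ : X →L[ℂ] X) (0 - (g₀ : X)) with hf
  have hf1 : ‖f‖ = 1 := tendsto_nhds_unique hu.norm (by simp [hu1])
  have hfS : f ∈ S := hSc.mem_of_tendsto hu (Eventually.of_forall fun n => huS _)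
  have hBf : B f = 0 := tendsto_nhds_unique ((B.continuous.tendsto f).comp hu)
    (hBu.comp hφ.tendsto_atTop)
  refine ⟨l, hlm, f, hfS, ?_, ?_⟩
  · rintro h0
    rw [h0, norm_zero] at hf1
    exact zero_ne_one hf1
  · rw [hBx] at hBf
    exact sub_eq_zero.1 hBf

/-- The variational principle: if the quadratic form of `T` is below `m` on an `n`-dimensional
space then `T` has at least `n` eigenvalues below `m`, hence below its essential spectrum. -/
theorem hasAtLeastEigenvaluesBelow_of_form_lt [CompleteSpace X] {T M : X →L[ℂ] X}
    (hT : (T : X →ₗ[ℂ] X).IsSymmetric)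
    (hV : (T - M : X →L[ℂ] X).toLinearMap.HasFiniteRange) {m : ℝ}
    (hM : ∀ x, m * ‖x‖ ^ 2 ≤ (inner ℂ (M x) x).re) {n : ℕ} (v : Fin n → X)
    (hv : ∀ c : Fin n → ℂ, c ≠ 0 → (inner ℂ (T (∑ i, c i • v i)) (∑ i, c i • v i)).re <
      m * ‖∑ i, c i • v i‖ ^ 2) : HasAtLeastEigenvaluesBelow T n := by
  set S : Submodule ℂ X := ⨆ z ∈ {z : ℝ | z < m},
    Module.End.eigenspace (T : X →ₗ[ℂ] X) (z : ℂ) with hS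
  have hle : S ≤ spanBelow T := by
    refine iSup₂_le fun z hz => ?_
    refine le_iSup₂_of_le (f := fun (z : ℝ) (_ : z ∈ {z : ℝ | ∀ s : ℝ, (s : ℂ) ∈ essSpectrum T →
      z < s}) => Module.End.eigenspace (T : X →ₗ[ℂ] X) (z : ℂ)) z (fun s hs => ?_) le_rfl
    by_contra hsz
    exact notMem_essSpectrum_of_lt hV (lt_of_le_of_lt (not_lt.1 hsz) hz) hM hs
  refine le_trans ?_ (Submodule.rank_mono hle)
  by_contra hlt
  rw [not_le] at hlt
  have : FiniteDimensional ℂ S :=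
    Module.rank_lt_aleph0_iff.1 (hlt.trans (Cardinal.natCast_lt_aleph0))
  have hfin : Module.finrank ℂ S < n := by
    rw [← Module.finrank_eq_rank] at hlt
    exact_mod_cast hlt
  -- If `S` had dimension below `n`, some nonzero combination of the `v i` would be orthogonal to
  -- `S`. The form is below `m` there, so `Sᗮ` would contain an eigenvector with eigenvalue below
  -- `m`, which also lies in `S`.
  let Φ : (Fin n → ℂ) →ₗ[ℂ] S :=
    (S.orthogonalProjectionOnto).toLinearMap ∘ₗ Fintype.linearCombination ℂ v
  have hker : Φ.ker ≠ ⊥ := LinearMap.ker_ne_bot_of_finrank_lt (by simpa using hfin)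
  obtain ⟨c, hc, hc0⟩ := (Submodule.ne_bot_iff _).1 hker
  have hw : ∑ i, c i • v i ∈ Sᗮ := by
    rw [← Submodule.orthogonalProjectionOnto_eq_zero_iff]
    exact hc
  have hTS : ∀ x ∈ S, T x ∈ S := by
    have : S ≤ S.comap (T : X →ₗ[ℂ] X) := by
      refine iSup₂_le fun z hz x hx => ?_
      have h1 : T x = (z : ℂ) • x := Module.End.mem_eigenspace_iff.1 hx
      change T x ∈ S
      rw [h1]
      exact S.smul_mem _ (le_iSup₂ (f := fun (z : ℝ) (_ : z ∈ {z : ℝ | z < m}) =>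
        Module.End.eigenspace (T : X →ₗ[ℂ] X) (z : ℂ)) z hz hx)
    exact this
  have hTS' : ∀ x ∈ Sᗮ, T x ∈ Sᗮ := by
    intro x hx y hy
    have h : inner ℂ (T y) x = inner ℂ y (T x) := hT y x
    rw [← h]
    exact hx _ (hTS y hy)
  obtain ⟨l, hl, x, hxS, hx0, hxl⟩ := exists_eigenvector_of_form_lt hT hV hM
    (Submodule.isClosed_orthogonal S) hTS' hw (hv c hc0)
  have hxS' : x ∈ S := le_iSup₂ (f := fun (z : ℝ) (_ : z ∈ {z : ℝ | z < m}) =>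
        Module.End.eigenspace (T : X →ₗ[ℂ] X) (z : ℂ)) l hl (Module.End.mem_eigenspace_iff.2 hxl)
  exact hx0 (inner_self_eq_zero.1 (hxS x hxS'))

theorem neg_mem_essSpectrum_neg {T : X →L[ℂ] X} {z : ℂ} (hz : z ∈ essSpectrum T) :
    -z ∈ essSpectrum (-T) := by
  intro h
  obtain ⟨v, hv⟩ := h.exists_isQuasiInverse
  refine hz (ContinuousLinearMap.IsFredholm.of_isQuasiInverse (v := -v) ?_)
  have e : T - z • ContinuousLinearMap.id ℂ X = -(-T - (-z) • ContinuousLinearMap.id ℂ X) := by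
    ext x
    simp
    abel
  set u : X →L[ℂ] X := -T - (-z) • ContinuousLinearMap.id ℂ X
  have e1 : (-v).toLinearMap ∘ₗ (-u).toLinearMap = v.toLinearMap ∘ₗ u.toLinearMap := by
    ext x
    simp
  have e2 : (-u).toLinearMap ∘ₗ (-v).toLinearMap = u.toLinearMap ∘ₗ v.toLinearMap := by
    ext x
    simp
  rw [e]
  refine ⟨?_, ?_⟩
  · rw [LinearMap.IsLeftQuasiInverse, e1]
    exact hv.1
  · rw [LinearMap.IsRightQuasiInverse, e2]
    exact hv.2

theorem HasAtLeastEigenvaluesBelow.above_of_neg {T : X →L[ℂ] X} {n : ℕ}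
    (h : HasAtLeastEigenvaluesBelow (-T) n) : HasAtLeastEigenvaluesAbove T n := by
  refine le_trans h (Submodule.rank_mono ?_)
  refine iSup₂_le fun z hz x hx => ?_
  refine le_iSup₂ (f := fun (z : ℝ) (_ : z ∈ {z : ℝ | ∀ s : ℝ, (s : ℂ) ∈ essSpectrum T →
      s < z}) => Module.End.eigenspace (T : X →ₗ[ℂ] X) (z : ℂ)) (-z) (fun s hs => ?_) ?_
  · have h1 := hz (-s) (by simpa using neg_mem_essSpectrum_neg hs)
    linarith
  · rw [Module.End.mem_eigenspace_iff] at hx ⊢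
    have hx' : -(T x) = (z : ℂ) • x := hx
    change T x = _
    rw [← neg_neg (T x), hx']
    simp

end Abstract

/-! ### The quadratic form of the Hamiltonian -/

/-- Even functions are the fixed points of the isometry induced by reflection. Closedness supplies
the completeness that the variational principle needs. -/
theorem isClosed_evenL2 : IsClosed (evenL2 : Set L2) := by
  let U := Lp.compMeasurePreservingₗᵢ ℂ (E := ℂ) (p := 2) (fun p : Fin 3 → ℝ => -p)
    measurePreserving_neg
  have h : (evenL2 : Set L2) = {f | U f = f} := by
    ext f
    change (∀ᵐ p ∂torusMeasure, f (-p) = f p) ↔ U f = f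
    have h1 : U f =ᵐ[torusMeasure] fun p => f (-p) :=
      Lp.coeFn_compMeasurePreserving f measurePreserving_neg
    rw [Lp.ext_iff]
    constructor
    · intro h
      filter_upwards [h1, h] with p hp hp'
      rw [hp, hp']
    · intro h
      filter_upwards [h1, h] with p hp hp'
      rw [← hp, hp']
  rw [h]
  exact isClosed_eq U.continuous continuous_id

instance completeSpace_evenL2 : CompleteSpace evenL2 :=
  isClosed_evenL2.completeSpace_coe

theorem inner_mulOp {φ : (Fin 3 → ℝ) → ℝ} (hφ : Continuous φ) {C : ℝ} (hC : ∀ p, |φ p| ≤ C)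
    (f g : L2) : inner ℂ (mulOp φ hφ C hC f) g =
      ∫ p, (φ p : ℂ) * inner ℂ (f p) (g p) ∂torusMeasure := by
  rw [L2.inner_def]
  refine integral_congr_ae ?_
  filter_upwards [mulOp_apply hφ hC f] with p hp
  rw [hp, ← smul_eq_mul, inner_smul_left, Complex.conj_ofReal]

theorem isSymmetric_mulOp {φ : (Fin 3 → ℝ) → ℝ} (hφ : Continuous φ) {C : ℝ}
    (hC : ∀ p, |φ p| ≤ C) : (mulOp φ hφ C hC : L2 →ₗ[ℂ] L2).IsSymmetric := by
  intro f g
  change inner ℂ (mulOp φ hφ C hC f) g = inner ℂ f (mulOp φ hφ C hC g)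
  rw [inner_mulOp, L2.inner_def]
  refine integral_congr_ae ?_
  filter_upwards [mulOp_apply hφ hC g] with p hp
  rw [hp, ← smul_eq_mul (φ p : ℂ) (g p), inner_smul_right]

theorem re_inner_mulOp_self {φ : (Fin 3 → ℝ) → ℝ} (hφ : Continuous φ) {C : ℝ}
    (hC : ∀ p, |φ p| ≤ C) (f : L2) : (inner ℂ (mulOp φ hφ C hC f) f).re =
      ∫ p, φ p * ‖f p‖ ^ 2 ∂torusMeasure := by
  have h : inner ℂ (mulOp φ hφ C hC f) f =
      ((∫ p, φ p * ‖f p‖ ^ 2 ∂torusMeasure : ℝ) : ℂ) := by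
    rw [inner_mulOp, ← integral_complex_ofReal]
    refine integral_congr_ae (Eventually.of_forall fun p => ?_)
    change (φ p : ℂ) * inner ℂ (f p) (f p) = ((φ p * ‖f p‖ ^ 2 : ℝ) : ℂ)
    rw [inner_self_eq_norm_sq_to_K]
    push_cast
    rfl
  rw [h, Complex.ofReal_re]

theorem integrable_mul_norm_sq {φ : (Fin 3 → ℝ) → ℝ} (hφ : Continuous φ) {C : ℝ}
    (hC : ∀ p, |φ p| ≤ C) (f : L2) : Integrable (fun p => φ p * ‖f p‖ ^ 2) torusMeasure :=
  ((Lp.memLp f).integrable_norm_pow two_ne_zero).bdd_mul hφ.aestronglyMeasurable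
    (Eventually.of_forall fun p => hC p)

theorem isSymmetric_rankOne {φ : (Fin 3 → ℝ) → ℝ} (hφ : Continuous φ) {C : ℝ}
    (hC : ∀ p, |φ p| ≤ C) : (rankOne φ hφ C hC : L2 →ₗ[ℂ] L2).IsSymmetric := by
  intro f g
  change inner ℂ (inner ℂ ((memLp_ofReal hφ hC 2).toLp _ : L2) f •
    ((memLp_ofReal hφ hC 2).toLp _ : L2)) g = inner ℂ f (inner ℂ
      ((memLp_ofReal hφ hC 2).toLp _ : L2) g • ((memLp_ofReal hφ hC 2).toLp _ : L2))
  rw [inner_smul_left, inner_smul_right, inner_conj_symm, mul_comm]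

theorem hasFiniteRange_rankOne {φ : (Fin 3 → ℝ) → ℝ} (hφ : Continuous φ) {C : ℝ}
    (hC : ∀ p, |φ p| ≤ C) : (rankOne φ hφ C hC).toLinearMap.HasFiniteRange := by
  have h : (rankOne φ hφ C hC).toLinearMap =
      (LinearMap.toSpanSingleton ℂ L2 ((memLp_ofReal hφ hC 2).toLp _)) ∘ₗ
        (innerSL ℂ ((memLp_ofReal hφ hC 2).toLp _ : L2)).toLinearMap := rfl
  rw [h]
  exact LinearMap.HasFiniteRange.of_finite_dom.comp_right _

theorem hasFiniteRange_interaction (μ₁ μ₂ : ℝ) :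
    (interaction μ₁ μ₂).toLinearMap.HasFiniteRange := by
  have h : (interaction μ₁ μ₂).toLinearMap =
      ((μ₁ / (2 * Real.pi) ^ 3 : ℝ) : ℂ) • (rankOne (fun _ => 1) continuous_const 1
        (fun _ => by simp)).toLinearMap +
      ((2 * μ₂ / (2 * Real.pi) ^ 3 : ℝ) : ℂ) •
        ((rankOne (fun p => Real.cos (p 0)) (continuous_cosCoord 0) 1
          (fun p => Real.abs_cos_le_one (p 0))).toLinearMap +
        (rankOne (fun p => Real.cos (p 1)) (continuous_cosCoord 1) 1
          (fun p => Real.abs_cos_le_one (p 1))).toLinearMap +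
        (rankOne (fun p => Real.cos (p 2)) (continuous_cosCoord 2) 1
          (fun p => Real.abs_cos_le_one (p 2))).toLinearMap) := by
    rw [interaction, Fin.sum_univ_three]
    rfl
  rw [h]
  exact ((hasFiniteRange_rankOne _ _).smul _).add
    ((((hasFiniteRange_rankOne _ _).add (hasFiniteRange_rankOne _ _)).add
      (hasFiniteRange_rankOne _ _)).smul _)

theorem isSymmetric_interaction (μ₁ μ₂ : ℝ) :
    (interaction μ₁ μ₂ : L2 →ₗ[ℂ] L2).IsSymmetric := by
  intro f g
  change inner ℂ (interaction μ₁ μ₂ f) g = inner ℂ f (interaction μ₁ μ₂ g)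
  have h0 := isSymmetric_rankOne (φ := fun _ => 1) continuous_const (C := 1) (fun _ => by simp) f g
  have hi := fun i => isSymmetric_rankOne (continuous_cosCoord i)
    (fun p => Real.abs_cos_le_one (p i)) f g
  simp only [ContinuousLinearMap.coe_coe] at h0 hi
  simp only [interaction, add_apply, smul_apply, Fin.sum_univ_three, inner_add_left,
    inner_add_right, inner_smul_left, inner_smul_right, Complex.conj_ofReal, h0, hi]

/-- The dispersion at zero quasimomentum measured from the lower (`σ = 1`) or the upper (`σ = -1`)
edge of its range. -/
def edgeDispersion (σ : ℝ) (p : Fin 3 → ℝ) : ℝ := 4 * ∑ i, (1 - σ * Real.cos (p i))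

theorem continuous_edgeDispersion (σ : ℝ) : Continuous (edgeDispersion σ) := by
  unfold edgeDispersion
  fun_prop

theorem edgeDispersion_eq (σ : ℝ) (p : Fin 3 → ℝ) : edgeDispersion σ p =
    12 - 4 * σ * (Real.cos (p 0) + Real.cos (p 1) + Real.cos (p 2)) := by
  rw [edgeDispersion, Fin.sum_univ_three]
  ring

theorem sign_mul_cos_le {σ : ℝ} (hσ : σ = 1 ∨ σ = -1) (x : ℝ) : |σ * Real.cos x| ≤ 1 := by
  rcases hσ with rfl | rfl <;> simpa using Real.abs_cos_le_one x

theorem edgeDispersion_nonneg {σ : ℝ} (hσ : σ = 1 ∨ σ = -1) (p : Fin 3 → ℝ) :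
    0 ≤ edgeDispersion σ p :=
  mul_nonneg (by norm_num) (Finset.sum_nonneg fun i _ => by
    linarith [(abs_le.1 (sign_mul_cos_le hσ (p i))).2])

theorem edgeDispersion_le {σ : ℝ} (hσ : σ = 1 ∨ σ = -1) (p : Fin 3 → ℝ) :
    edgeDispersion σ p ≤ 24 := by
  rw [edgeDispersion, Fin.sum_univ_three]
  linarith [(abs_le.1 (sign_mul_cos_le hσ (p 0))).1, (abs_le.1 (sign_mul_cos_le hσ (p 1))).1,
    (abs_le.1 (sign_mul_cos_le hσ (p 2))).1]

theorem abs_edgeDispersion_le {σ : ℝ} (hσ : σ = 1 ∨ σ = -1) (p : Fin 3 → ℝ) :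
    |edgeDispersion σ p| ≤ 24 := by
  rw [abs_of_nonneg (edgeDispersion_nonneg hσ p)]
  exact edgeDispersion_le hσ p

/-- Bounded continuous real even functions. -/
structure IsTrial (F : (Fin 3 → ℝ) → ℝ) : Prop where
  continuous : Continuous F
  bounded : ∃ C, ∀ p, |F p| ≤ C
  even : ∀ p, F (-p) = F p

theorem IsTrial.memLp {F : (Fin 3 → ℝ) → ℝ} (hF : IsTrial F) (q : ENNReal) :
    MemLp (fun p => (F p : ℂ)) q torusMeasure :=
  memLp_ofReal hF.continuous hF.bounded.choose_spec q

/-- A trial function as an element of `L^{2,e}(𝕋³)`. -/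
def IsTrial.toEven {F : (Fin 3 → ℝ) → ℝ} (hF : IsTrial F) : evenL2 :=
  ⟨(hF.memLp 2).toLp _, by
    rw [mem_evenL2]
    have h := (hF.memLp 2).coeFn_toLp
    filter_upwards [h, measurePreserving_neg.quasiMeasurePreserving.ae h] with p h1 h2
    rw [h1, h2, hF.even]⟩

theorem IsTrial.coe_toEven {F : (Fin 3 → ℝ) → ℝ} (hF : IsTrial F) :
    ((hF.toEven : L2) : (Fin 3 → ℝ) → ℂ) =ᵐ[torusMeasure] fun p => (F p : ℂ) :=
  (hF.memLp 2).coeFn_toLp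

/-- The sesquilinear form of the Hamiltonian at zero quasimomentum, measured from the edge
of the continuous spectrum, evaluated at real functions. -/
def trialForm (σ μ₁ μ₂ : ℝ) (F G : (Fin 3 → ℝ) → ℝ) : ℝ :=
  ∫ p, edgeDispersion σ p * (F p * G p) ∂torusMeasure +
    σ * (μ₁ / (2 * Real.pi) ^ 3 * ((∫ p, F p ∂torusMeasure) * ∫ p, G p ∂torusMeasure) +
      2 * μ₂ / (2 * Real.pi) ^ 3 * ∑ i : Fin 3, (∫ p, Real.cos (p i) * F p ∂torusMeasure) *
        ∫ p, Real.cos (p i) * G p ∂torusMeasure)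

theorem inner_rankOne_trial {φ : (Fin 3 → ℝ) → ℝ} (hφ : Continuous φ) {C : ℝ}
    (hC : ∀ p, |φ p| ≤ C) {F G : (Fin 3 → ℝ) → ℝ} (hF : IsTrial F) (hG : IsTrial G) :
    inner ℂ (rankOne φ hφ C hC (hF.toEven : L2)) (hG.toEven : L2) =
      (((∫ p, φ p * F p ∂torusMeasure) * ∫ p, φ p * G p ∂torusMeasure : ℝ) : ℂ) := by
  have key : ∀ {H : (Fin 3 → ℝ) → ℝ} (hH : IsTrial H),
      inner ℂ ((memLp_ofReal hφ hC 2).toLp _ : L2) (hH.toEven : L2) =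
        ((∫ p, φ p * H p ∂torusMeasure : ℝ) : ℂ) := by
    intro H hH
    rw [L2.inner_def, ← integral_complex_ofReal]
    refine integral_congr_ae ?_
    filter_upwards [(memLp_ofReal hφ hC 2).coeFn_toLp, hH.coe_toEven] with p h1 h2
    rw [h1, h2]
    simp [mul_comm]
  change inner ℂ (inner ℂ ((memLp_ofReal hφ hC 2).toLp _ : L2) (hF.toEven : L2) •
    ((memLp_ofReal hφ hC 2).toLp _ : L2)) _ = _
  rw [inner_smul_left, key hF, key hG, Complex.conj_ofReal, Complex.ofReal_mul]

theorem inner_mulOp_trial {φ : (Fin 3 → ℝ) → ℝ} (hφ : Continuous φ) {C : ℝ}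
    (hC : ∀ p, |φ p| ≤ C) {F G : (Fin 3 → ℝ) → ℝ} (hF : IsTrial F) (hG : IsTrial G) :
    inner ℂ (mulOp φ hφ C hC (hF.toEven : L2)) (hG.toEven : L2) =
      ((∫ p, φ p * (F p * G p) ∂torusMeasure : ℝ) : ℂ) := by
  rw [inner_mulOp, ← integral_complex_ofReal]
  refine integral_congr_ae ?_
  filter_upwards [hF.coe_toEven, hG.coe_toEven] with p h1 h2
  rw [h1, h2]
  simp [mul_comm]

theorem inner_edge_trial {σ : ℝ} (hσ : σ = 1 ∨ σ = -1) (μ₁ μ₂ : ℝ) {F G : (Fin 3 → ℝ) → ℝ}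
    (hF : IsTrial F) (hG : IsTrial G) :
    inner ℂ ((mulOp (edgeDispersion σ) (continuous_edgeDispersion σ) 24
        (abs_edgeDispersion_le hσ) + (σ : ℂ) • interaction μ₁ μ₂) (hF.toEven : L2))
      (hG.toEven : L2) = (trialForm σ μ₁ μ₂ F G : ℂ) := by
  simp only [interaction, add_apply, smul_apply, Fin.sum_univ_three, inner_add_left,
    inner_smul_left, Complex.conj_ofReal, inner_mulOp_trial, inner_rankOne_trial, trialForm]
  push_cast
  simp only [one_mul]

/-- Both bounds are pointwise: `σ𝓔_K - m` is a sum of the nonnegative terms `4 (1 - σ cos pᵢ)`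
weighted by `cos (Kᵢ/2) ∈ [0, 1]`, so it lies between zero and `edgeDispersion σ`. The interaction
does not depend on `K` and cancels from the comparison. -/
theorem re_inner_hamiltonian_sub_le {σ : ℝ} (hσ : σ = 1 ∨ σ = -1) (μ₁ μ₂ : ℝ) {K : Fin 3 → ℝ}
    (hK : ∀ i, 0 ≤ Real.cos (K i / 2)) (f : L2) :
    (inner ℂ (((σ : ℂ) • (freeOp K + interaction μ₁ μ₂)) f) f).re -
        (12 * σ - 4 * ∑ i, Real.cos (K i / 2)) * ‖f‖ ^ 2 ≤
      (inner ℂ ((mulOp (edgeDispersion σ) (continuous_edgeDispersion σ) 24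
        (abs_edgeDispersion_le hσ) + (σ : ℂ) • interaction μ₁ μ₂) f) f).re ∧
    (12 * σ - 4 * ∑ i, Real.cos (K i / 2)) * ‖f‖ ^ 2 ≤
      (inner ℂ (((σ : ℂ) • freeOp K) f) f).re := by
  set m : ℝ := 12 * σ - 4 * ∑ i, Real.cos (K i / 2) with hm
  have hn : ‖f‖ ^ 2 = ∫ p, ‖f p‖ ^ 2 ∂torusMeasure := by
    have h1 : inner ℂ f f = ((∫ p, ‖f p‖ ^ 2 ∂torusMeasure : ℝ) : ℂ) := by
      rw [L2.inner_def, ← integral_complex_ofReal]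
      refine integral_congr_ae (Eventually.of_forall fun p => ?_)
      change inner ℂ (f p) (f p) = ((‖f p‖ ^ 2 : ℝ) : ℂ)
      rw [inner_self_eq_norm_sq_to_K]
      push_cast
      rfl
    have h2 : (inner ℂ f f).re = ‖f‖ ^ 2 := inner_self_eq_norm_sq (𝕜 := ℂ) f
    rw [← h2, h1, Complex.ofReal_re]
  have hi := (Lp.memLp f).integrable_norm_pow two_ne_zero
  have hiK := integrable_mul_norm_sq (continuous_dispersion K) (abs_dispersion_le K) f
  have hiσ := integrable_mul_norm_sq (continuous_edgeDispersion σ) (abs_edgeDispersion_le hσ) f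
  have hfree : (inner ℂ (freeOp K f) f).re = ∫ p, dispersion K p * ‖f p‖ ^ 2 ∂torusMeasure :=
    re_inner_mulOp_self (continuous_dispersion K) (abs_dispersion_le K) f
  have hid : ∀ p, σ * dispersion K p - m = 4 * ∑ i, Real.cos (K i / 2) *
      (1 - σ * Real.cos (p i)) := by
    intro p
    simp only [hm, dispersion, Fin.sum_univ_three]
    ring
  have hnn : ∀ (p : Fin 3 → ℝ) (i : Fin 3), 0 ≤ 1 - σ * Real.cos (p i) := fun p i => by
    linarith [(abs_le.1 (sign_mul_cos_le hσ (p i))).2]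
  have h0 : ∀ p, m ≤ σ * dispersion K p := by
    intro p
    have : 0 ≤ ∑ i, Real.cos (K i / 2) * (1 - σ * Real.cos (p i)) :=
      Finset.sum_nonneg fun i _ => mul_nonneg (hK i) (hnn p i)
    linarith [hid p]
  have h1 : ∀ p, σ * dispersion K p - m ≤ edgeDispersion σ p := by
    intro p
    rw [hid, edgeDispersion]
    gcongr with i
    exact mul_le_of_le_one_left (hnn p i) (Real.cos_le_one _)
  constructor
  · simp only [add_apply, smul_apply, inner_add_left, inner_smul_left, Complex.conj_ofReal,
      Complex.add_re, Complex.re_ofReal_mul, re_inner_mulOp_self, hfree, mul_add]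
    have h2 : σ * ∫ p, dispersion K p * ‖f p‖ ^ 2 ∂torusMeasure - m * ‖f‖ ^ 2 ≤
        ∫ p, edgeDispersion σ p * ‖f p‖ ^ 2 ∂torusMeasure := by
      rw [hn, ← integral_const_mul, ← integral_const_mul,
        ← integral_sub (hiK.const_mul σ) (hi.const_mul m)]
      refine integral_mono ((hiK.const_mul σ).sub (hi.const_mul m)) hiσ fun p => ?_
      have := mul_le_mul_of_nonneg_right (h1 p) (sq_nonneg ‖f p‖)
      change σ * (dispersion K p * ‖f p‖ ^ 2) - m * ‖f p‖ ^ 2 ≤ edgeDispersion σ p * ‖f p‖ ^ 2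
      linarith
    linarith
  · simp only [smul_apply, inner_smul_left, Complex.conj_ofReal, Complex.re_ofReal_mul, hfree]
    rw [hn, ← integral_const_mul, ← integral_const_mul]
    refine integral_mono (hi.const_mul m) (hiK.const_mul σ) fun p => ?_
    have := mul_le_mul_of_nonneg_right (h0 p) (sq_nonneg ‖f p‖)
    change m * ‖f p‖ ^ 2 ≤ σ * (dispersion K p * ‖f p‖ ^ 2)
    linarith

theorem freeOp_mem (K : Fin 3 → ℝ) : ∀ f ∈ evenL2, freeOp K f ∈ evenL2 := by
  intro f hf
  have h := fullHamiltonian_mem 0 0 K f hf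
  simpa [interaction] using h

/-- If the form at zero quasimomentum is diagonal and negative on `n` trial functions, then for
every quasimomentum `σ • H(K)` has at least `n` eigenvalues below its essential spectrum. -/
theorem hasAtLeastEigenvaluesBelow_of_trial {σ : ℝ} (hσ : σ = 1 ∨ σ = -1) (μ₁ μ₂ : ℝ)
    {K : Fin 3 → ℝ} (hK : ∀ i, 0 ≤ Real.cos (K i / 2)) {n : ℕ} (F : Fin n → (Fin 3 → ℝ) → ℝ)
    (hF : ∀ i, IsTrial (F i)) (hoff : ∀ i j, i ≠ j → trialForm σ μ₁ μ₂ (F i) (F j) = 0)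
    (hdiag : ∀ i, trialForm σ μ₁ μ₂ (F i) (F i) < 0) :
    HasAtLeastEigenvaluesBelow ((σ : ℂ) • hamiltonian μ₁ μ₂ K) n := by
  refine hasAtLeastEigenvaluesBelow_of_form_lt
    (M := (σ : ℂ) • (freeOp K).restrict (freeOp_mem K))
    (m := 12 * σ - 4 * ∑ i, Real.cos (K i / 2)) ?_ ?_ ?_ (fun i => (hF i).toEven) ?_
  · intro f g
    change inner ℂ ((σ : ℂ) • (freeOp K f + interaction μ₁ μ₂ f : L2)) (g : L2) =
      inner ℂ (f : L2) ((σ : ℂ) • (freeOp K g + interaction μ₁ μ₂ g : L2))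
    have h1 : inner ℂ (freeOp K f) (g : L2) = inner ℂ (f : L2) (freeOp K g) :=
      isSymmetric_mulOp _ _ _ _
    have h2 : inner ℂ (interaction μ₁ μ₂ f) (g : L2) = inner ℂ (f : L2) (interaction μ₁ μ₂ g) :=
      isSymmetric_interaction _ _ _ _
    rw [inner_smul_left, inner_smul_right, Complex.conj_ofReal, inner_add_left, inner_add_right,
      h1, h2]
  -- Finite rank is checked after inclusion into `L2`, where the difference is the interaction, and
  -- pulled back by injectivity of the inclusion.
  · have hfin : (evenL2.subtype ∘ₗ ((σ : ℂ) • hamiltonian μ₁ μ₂ K - (σ : ℂ) •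
        (freeOp K).restrict (freeOp_mem K) : evenL2 →L[ℂ] evenL2).toLinearMap).HasFiniteRange := by
      have e : evenL2.subtype ∘ₗ ((σ : ℂ) • hamiltonian μ₁ μ₂ K - (σ : ℂ) •
          (freeOp K).restrict (freeOp_mem K) : evenL2 →L[ℂ] evenL2).toLinearMap =
          ((σ : ℂ) • (interaction μ₁ μ₂).toLinearMap) ∘ₗ evenL2.subtype := by
        refine LinearMap.ext fun f => ?_
        change (σ : ℂ) • (freeOp K f + interaction μ₁ μ₂ f : L2) - (σ : ℂ) • freeOp K f =
          (σ : ℂ) • interaction μ₁ μ₂ f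
        rw [smul_add, add_sub_cancel_left]
      rw [e]
      exact ((hasFiniteRange_interaction μ₁ μ₂).smul _).comp_right _
    rw [LinearMap.hasFiniteRange_iff_range, LinearMap.range_comp] at hfin
    rw [LinearMap.hasFiniteRange_iff_range]
    exact Submodule.fg_of_fg_map_injective _ evenL2.injective_subtype hfin
  · intro f
    exact (re_inner_hamiltonian_sub_le hσ μ₁ μ₂ hK (f : L2)).2
  · intro c hc
    set B : L2 →L[ℂ] L2 := mulOp (edgeDispersion σ) (continuous_edgeDispersion σ) 24
        (abs_edgeDispersion_le hσ) + (σ : ℂ) • interaction μ₁ μ₂ with hB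
    set w : evenL2 := ∑ i, c i • (hF i).toEven with hw
    have hwc : (w : L2) = ∑ i, c i • ((hF i).toEven : L2) := by
      simp [hw]
    have h1 := (re_inner_hamiltonian_sub_le hσ μ₁ μ₂ hK (w : L2)).1
    -- Form-orthogonality removes the cross terms, so the complex coefficients enter only through
    -- `‖c i‖ ^ 2`.
    have h2 : inner ℂ (B (w : L2)) (w : L2) =
        ((∑ i, ‖c i‖ ^ 2 * trialForm σ μ₁ μ₂ (F i) (F i) : ℝ) : ℂ) := by
      rw [hwc, map_sum, sum_inner]
      push_cast
      refine Finset.sum_congr rfl fun i _ => ?_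
      rw [inner_sum, Finset.sum_eq_single i]
      · rw [map_smul, inner_smul_left, inner_smul_right, hB, inner_edge_trial hσ, ← mul_assoc,
          Complex.conj_mul']
      · intro j _ hj
        rw [map_smul, inner_smul_left, inner_smul_right, hB, inner_edge_trial hσ,
          hoff i j (Ne.symm hj)]
        simp
      · simp
    rw [h2, Complex.ofReal_re] at h1
    have h3 : ∑ i, ‖c i‖ ^ 2 * trialForm σ μ₁ μ₂ (F i) (F i) < 0 := by
      obtain ⟨i, hi⟩ := Function.ne_iff.1 hc
      refine Finset.sum_neg' (fun j _ => ?_) ⟨i, Finset.mem_univ _, ?_⟩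
      · exact mul_nonpos_of_nonneg_of_nonpos (sq_nonneg _) (hdiag j).le
      · exact mul_neg_of_pos_of_neg (by have := norm_pos_iff.2 hi; positivity) (hdiag i)
    exact sub_neg.1 (h1.trans_lt h3)

/-! ### Symmetries and positivity of integrals over the torus -/

theorem torusMeasure_eq_pi : torusMeasure =
    Measure.pi fun _ : Fin 3 => (volume : Measure ℝ).restrict (Set.Ico (-Real.pi) Real.pi) := by
  rw [torusMeasure, torus, volume_pi, Measure.restrict_pi_pi]

theorem measurePreserving_comp_perm (e : Equiv.Perm (Fin 3)) :
    MeasurePreserving (MeasurableEquiv.piCongrLeft (fun _ : Fin 3 => ℝ) e)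
      torusMeasure torusMeasure := by
  rw [torusMeasure_eq_pi]
  exact measurePreserving_piCongrLeft (α := fun _ : Fin 3 => ℝ)
    (fun _ : Fin 3 => (volume : Measure ℝ).restrict (Set.Ico (-Real.pi) Real.pi)) e

theorem integral_comp_perm (e : Equiv.Perm (Fin 3)) (g : (Fin 3 → ℝ) → ℝ) :
    ∫ p, g (fun i => p (e i)) ∂torusMeasure = ∫ p, g p ∂torusMeasure := by
  rw [← (measurePreserving_comp_perm e.symm).integral_comp' g]
  refine integral_congr_ae (Eventually.of_forall fun p => ?_)
  refine congrArg g (funext fun i => ?_)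
  have h := MeasurableEquiv.piCongrLeft_apply_apply (β := fun _ : Fin 3 => ℝ) e.symm p (e i)
  rw [Equiv.symm_apply_apply] at h
  exact h.symm

/-- Translation by `π` on `[-π, π)` modulo `2π`. -/
def halfShift (x : ℝ) : ℝ := if x < 0 then x + Real.pi else x - Real.pi

theorem cos_halfShift (x : ℝ) : Real.cos (halfShift x) = -Real.cos x := by
  unfold halfShift
  split_ifs
  · exact Real.cos_add_pi x
  · exact Real.cos_sub_pi x

theorem measurable_halfShift : Measurable halfShift :=
  Measurable.ite measurableSet_Iio (measurable_id.add_const _) (measurable_id.sub_const _)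

/-- The map interchanges `[-π, 0)` and `[0, π)`, acting on each by a translation. -/
theorem measurePreserving_halfShift : MeasurePreserving halfShift
    ((volume : Measure ℝ).restrict (Set.Ico (-Real.pi) Real.pi))
    ((volume : Measure ℝ).restrict (Set.Ico (-Real.pi) Real.pi)) := by
  refine ⟨measurable_halfShift, Measure.ext fun s hs => ?_⟩
  have hpi := Real.pi_pos
  rw [Measure.map_apply measurable_halfShift hs, Measure.restrict_apply hs,
    Measure.restrict_apply (measurable_halfShift hs)]
  have e1 : halfShift ⁻¹' s ∩ Set.Ico (-Real.pi) Real.pi =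
      (fun x => x + Real.pi) ⁻¹' (s ∩ Set.Ico 0 Real.pi) ∪
        (fun x => x + -Real.pi) ⁻¹' (s ∩ Set.Ico (-Real.pi) 0) := by
    ext x
    simp only [Set.mem_inter_iff, Set.mem_preimage, Set.mem_Ico, Set.mem_union, halfShift]
    split_ifs with h
    · constructor
      · rintro ⟨h1, h2, h3⟩
        exact Or.inl ⟨h1, by linarith, by linarith⟩
      · rintro (⟨h1, h2, h3⟩ | ⟨h1, h2, h3⟩)
        · exact ⟨h1, by linarith, by linarith⟩
        · linarith
    · constructor
      · rintro ⟨h1, h2, h3⟩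
        exact Or.inr ⟨h1, by linarith, by linarith⟩
      · rintro (⟨h1, h2, h3⟩ | ⟨h1, h2, h3⟩)
        · linarith
        · exact ⟨h1, by linarith, by linarith⟩
  have e2 : s ∩ Set.Ico (-Real.pi) Real.pi = (s ∩ Set.Ico 0 Real.pi) ∪
      (s ∩ Set.Ico (-Real.pi) 0) := by
    rw [← Set.inter_union_distrib_left, Set.union_comm, Set.Ico_union_Ico_eq_Ico] <;> linarith
  have d1 : Disjoint ((fun x : ℝ => x + Real.pi) ⁻¹' (s ∩ Set.Ico 0 Real.pi))
      ((fun x => x + -Real.pi) ⁻¹' (s ∩ Set.Ico (-Real.pi) 0)) := by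
    rw [Set.disjoint_left]
    rintro x ⟨-, -, h1⟩ ⟨-, h2, -⟩
    linarith
  have d2 : Disjoint (s ∩ Set.Ico 0 Real.pi) (s ∩ Set.Ico (-Real.pi) 0) := by
    rw [Set.disjoint_left]
    rintro x ⟨-, h1, -⟩ ⟨-, -, h2⟩
    linarith
  rw [e1, e2, measure_union d1 ((hs.inter measurableSet_Ico).preimage (measurable_add_const _)),
    measure_union d2 (hs.inter measurableSet_Ico), measure_preimage_add_right,
    measure_preimage_add_right]

theorem integral_comp_halfShift {g : (Fin 3 → ℝ) → ℝ} (hg : Continuous g) :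
    ∫ p, g (fun i => halfShift (p i)) ∂torusMeasure = ∫ p, g p ∂torusMeasure := by
  have h : MeasurePreserving (fun (p : Fin 3 → ℝ) i => halfShift (p i))
      torusMeasure torusMeasure := by
    rw [torusMeasure_eq_pi]
    exact measurePreserving_pi _ _ fun _ => measurePreserving_halfShift
  conv_rhs => rw [← h.map_eq]
  rw [integral_map h.measurable.aemeasurable hg.aestronglyMeasurable]

theorem integrable_torus_of_continuous {g : (Fin 3 → ℝ) → ℝ} (hg : Continuous g) :
    Integrable g torusMeasure := by
  rw [torusMeasure_eq]
  exact hg.continuousOn.integrableOn_compact isCompact_Icc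

theorem integral_torus_pos {g : (Fin 3 → ℝ) → ℝ} (hg : Continuous g) (hg0 : ∀ p, 0 ≤ g p)
    {q : Fin 3 → ℝ} (hq : ∀ i, q i ∈ Set.Ioo (-Real.pi) Real.pi) (hgq : g q ≠ 0) :
    0 < ∫ p, g p ∂torusMeasure := by
  rw [integral_pos_iff_support_of_nonneg hg0 (integrable_torus_of_continuous hg)]
  have ho : IsOpen (Function.support g ∩ Set.univ.pi fun _ : Fin 3 =>
      Set.Ioo (-Real.pi) Real.pi) :=
    (isOpen_ne.preimage hg).inter (isOpen_set_pi Set.finite_univ fun _ _ => isOpen_Ioo)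
  have hpos := ho.measure_pos volume ⟨q, hgq, fun i _ => hq i⟩
  refine hpos.trans_le ?_
  rw [torusMeasure, Measure.restrict_apply (show MeasurableSet (Function.support g) from
    (isOpen_ne.preimage hg).measurableSet)]
  refine measure_mono (Set.inter_subset_inter_right _ ?_)
  exact Set.pi_mono fun i _ => Set.Ioo_subset_Ico_self

/-! ### Integrability of `1 / 𝓔₀` -/

theorem integrableOn_abs_rpow {r : ℝ} (hr : -1 < r) :
    IntegrableOn (fun x : ℝ => |x| ^ r) (Set.Ico (-Real.pi) Real.pi) := by
  have h : IntervalIntegrable (fun x : ℝ => |x| ^ r) volume (-Real.pi) Real.pi := by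
    refine intervalIntegrable_of_even (fun x => by rw [abs_neg]) fun x hx => ?_
    refine (intervalIntegral.intervalIntegrable_rpow' hr (a := 0) (b := x)).congr ?_
    intro y hy
    rw [Set.uIoc_of_le hx.le] at hy
    simp only [abs_of_pos hy.1]
  exact integrableOn_Icc_iff_integrableOn_Ico (by simp) |>.1
    ((intervalIntegrable_iff_integrableOn_Icc_of_le (by linarith [Real.pi_pos])).1 h)

/-- Combines `1 - cos x ≥ 2x²/π²` on `[-π, π]` with the inequality of arithmetic and geometric
means. The singularity of `1/𝓔` is thereby dominated by a product of one-variable factors `|pᵢ| ^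
(-2/3)`, each integrable because `2/3 < 1`. -/
theorem prod_rpow_le_edgeDispersion {p : Fin 3 → ℝ} (hp : p ∈ torus) :
    24 / Real.pi ^ 2 * ∏ i, |p i| ^ (2 / 3 : ℝ) ≤ edgeDispersion 1 p := by
  have hpi := Real.pi_pos
  have hc : ∀ i, 2 / Real.pi ^ 2 * p i ^ 2 ≤ 1 - Real.cos (p i) := by
    intro i
    have := Real.cos_le_one_sub_mul_cos_sq (x := p i)
      (abs_le.2 ⟨(hp i trivial).1, (hp i trivial).2.le⟩)
    linarith
  have ham := Real.geom_mean_le_arith_mean3_weighted (w₁ := 1 / 3) (w₂ := 1 / 3) (w₃ := 1 / 3)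
    (p₁ := |p 0| ^ 2) (p₂ := |p 1| ^ 2) (p₃ := |p 2| ^ 2) (by norm_num) (by norm_num) (by norm_num)
    (by positivity) (by positivity) (by positivity) (by norm_num)
  have hpow : ∀ i, (|p i| ^ 2) ^ (1 / 3 : ℝ) = |p i| ^ (2 / 3 : ℝ) := by
    intro i
    rw [← Real.rpow_natCast, ← Real.rpow_mul (abs_nonneg _)]
    norm_num
  simp only [hpow] at ham
  simp only [sq_abs] at ham
  rw [Fin.prod_univ_three, edgeDispersion, Fin.sum_univ_three]
  calc 24 / Real.pi ^ 2 * (|p 0| ^ (2 / 3 : ℝ) * |p 1| ^ (2 / 3 : ℝ) * |p 2| ^ (2 / 3 : ℝ))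
      ≤ 24 / Real.pi ^ 2 * (1 / 3 * p 0 ^ 2 + 1 / 3 * p 1 ^ 2 + 1 / 3 * p 2 ^ 2) := by gcongr
    _ = 4 * (2 / Real.pi ^ 2 * p 0 ^ 2 + 2 / Real.pi ^ 2 * p 1 ^ 2 +
          2 / Real.pi ^ 2 * p 2 ^ 2) := by ring
    _ ≤ _ := by linarith [hc 0, hc 1, hc 2]

theorem ae_forall_ne_zero : ∀ᵐ p ∂torusMeasure, ∀ i, p i ≠ 0 := by
  rw [ae_all_iff]
  intro i
  rw [torusMeasure_eq_pi]
  refine (Measure.quasiMeasurePreserving_eval (μ := fun _ : Fin 3 => (volume : Measure ℝ).restrict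
    (Set.Ico (-Real.pi) Real.pi)) i).ae (p := fun x => x ≠ 0) ?_
  exact ae_restrict_of_ae (Measure.ae_ne volume 0)

theorem ae_mem_torus : ∀ᵐ p ∂torusMeasure, p ∈ torus :=
  ae_restrict_mem (MeasurableSet.univ_pi fun _ => measurableSet_Ico)

theorem ae_edgeDispersion_pos : ∀ᵐ p ∂torusMeasure, 0 < edgeDispersion 1 p := by
  filter_upwards [ae_forall_ne_zero, ae_mem_torus] with p h1 h2
  refine lt_of_lt_of_le ?_ (prod_rpow_le_edgeDispersion h2)
  have := Real.pi_pos
  have : 0 < ∏ i, |p i| ^ (2 / 3 : ℝ) :=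
    Finset.prod_pos fun i _ => Real.rpow_pos_of_pos (abs_pos.2 (h1 i)) _
  positivity

theorem integrable_inv_edgeDispersion :
    Integrable (fun p => (edgeDispersion 1 p)⁻¹) torusMeasure := by
  have h : Integrable (fun p : Fin 3 → ℝ => Real.pi ^ 2 / 24 * ∏ i, |p i| ^ (-(2 / 3) : ℝ))
      torusMeasure := by
    rw [torusMeasure_eq_pi]
    exact (Integrable.fintype_prod fun _ => integrableOn_abs_rpow (by norm_num)).const_mul _
  refine h.mono' (continuous_edgeDispersion 1).measurable.inv.aestronglyMeasurable ?_
  filter_upwards [ae_forall_ne_zero, ae_mem_torus, ae_edgeDispersion_pos] with p h1 h2 h3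
  rw [Real.norm_eq_abs, abs_of_pos (inv_pos.2 h3)]
  have := Real.pi_pos
  have hpos : 0 < ∏ i, |p i| ^ (2 / 3 : ℝ) :=
    Finset.prod_pos fun i _ => Real.rpow_pos_of_pos (abs_pos.2 (h1 i)) _
  have e : Real.pi ^ 2 / 24 * ∏ i, |p i| ^ (-(2 / 3) : ℝ) =
      (24 / Real.pi ^ 2 * ∏ i, |p i| ^ (2 / 3 : ℝ))⁻¹ := by
    rw [mul_inv, inv_div, ← Finset.prod_inv_distrib]
    congr 1
    exact Finset.prod_congr rfl fun i _ => Real.rpow_neg (abs_nonneg _) _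
  rw [e]
  exact inv_anti₀ (by positivity) (prod_rpow_le_edgeDispersion h2)

theorem integrable_mul_inv_edgeDispersion {g : (Fin 3 → ℝ) → ℝ} (hg : Continuous g) {C : ℝ}
    (hC : ∀ p, |g p| ≤ C) :
    Integrable (fun p => g p * (edgeDispersion 1 p)⁻¹) torusMeasure :=
  integrable_inv_edgeDispersion.bdd_mul hg.aestronglyMeasurable (Eventually.of_forall hC)

/-- Dominated convergence with majorant `C/𝓔`. This is what allows strict inequalities at the edge
to be transferred to small `ε > 0`. -/
theorem tendsto_integral_mul_inv_edgeDispersion {g : (Fin 3 → ℝ) → ℝ} (hg : Continuous g) {C : ℝ}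
    (hC : ∀ p, |g p| ≤ C) :
    Tendsto (fun ε : ℝ => ∫ p, g p * (edgeDispersion 1 p + ε)⁻¹ ∂torusMeasure) (𝓝[>] 0)
      (𝓝 (∫ p, g p * (edgeDispersion 1 p)⁻¹ ∂torusMeasure)) := by
  refine tendsto_integral_filter_of_dominated_convergence
    (fun p => C * (edgeDispersion 1 p)⁻¹) (Eventually.of_forall fun ε => ?_) ?_
    (integrable_inv_edgeDispersion.const_mul C) ?_
  · exact (hg.measurable.mul
      ((continuous_edgeDispersion 1).measurable.add_const ε).inv).aestronglyMeasurable
  · filter_upwards [self_mem_nhdsWithin] with ε hε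
    filter_upwards [ae_edgeDispersion_pos] with p hp
    have hε' : (0 : ℝ) < ε := hε
    rw [Real.norm_eq_abs, abs_mul, abs_of_pos (inv_pos.2 (add_pos hp hε'))]
    have := (abs_nonneg _).trans (hC p)
    exact mul_le_mul (hC p) (inv_anti₀ hp (by linarith)) (inv_pos.2 (add_pos hp hε')).le this
  · filter_upwards [ae_edgeDispersion_pos] with p hp
    refine Tendsto.const_mul _ ?_
    have h : ContinuousAt (fun ε : ℝ => (edgeDispersion 1 p + ε)⁻¹) 0 :=
      ContinuousAt.inv₀ (by fun_prop) (by simpa using hp.ne')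
    have h2 := h.tendsto.mono_left (nhdsWithin_le_nhds (s := Set.Ioi 0))
    simpa using h2

/-! ### The normalized integral as a linear functional -/

/-- The mean over the torus of a continuous function. -/
def torusMean : C(Fin 3 → ℝ, ℝ) →ₗ[ℝ] ℝ where
  toFun g := ((2 * Real.pi) ^ 3)⁻¹ * ∫ p, g p ∂torusMeasure
  map_add' f g := by
    have h : ∫ p, (f + g) p ∂torusMeasure = ∫ p, f p ∂torusMeasure + ∫ p, g p ∂torusMeasure :=
      integral_add (integrable_torus_of_continuous f.continuous)
        (integrable_torus_of_continuous g.continuous)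
    rw [h, mul_add]
  map_smul' c f := by
    have h : ∫ p, (c • f) p ∂torusMeasure = c * ∫ p, f p ∂torusMeasure :=
      integral_const_mul c _
    rw [h, RingHom.id_apply, smul_eq_mul]
    ring

theorem torusMean_apply (g : C(Fin 3 → ℝ, ℝ)) :
    torusMean g = ((2 * Real.pi) ^ 3)⁻¹ * ∫ p, g p ∂torusMeasure := rfl

theorem torusMean_one : torusMean 1 = 1 := by
  have hpi := Real.pi_pos
  have h : torusMeasure.real Set.univ = (2 * Real.pi) ^ 3 := by
    rw [Measure.real, torusMeasure_eq_pi, Measure.pi_univ]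
    simp only [Measure.restrict_apply_univ, Real.volume_Ico, Finset.prod_const, Finset.card_univ,
      Fintype.card_fin, ENNReal.toReal_pow]
    rw [ENNReal.toReal_ofReal (by linarith)]
    ring
  have h1 : ∫ p, (1 : C(Fin 3 → ℝ, ℝ)) p ∂torusMeasure = (2 * Real.pi) ^ 3 := by
    simp [h]
  rw [torusMean_apply, h1]
  field_simp

theorem torusMean_mono {f g : C(Fin 3 → ℝ, ℝ)} (h : ∀ p, f p ≤ g p) :
    torusMean f ≤ torusMean g := by
  have := Real.pi_pos
  exact mul_le_mul_of_nonneg_left (integral_mono (integrable_torus_of_continuous f.continuous)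
    (integrable_torus_of_continuous g.continuous) h) (by positivity)

theorem torusMean_eq_of_perm (e : Equiv.Perm (Fin 3)) {f g : C(Fin 3 → ℝ, ℝ)}
    (h : ∀ p, f p = g (fun i => p (e i))) : torusMean f = torusMean g := by
  rw [torusMean_apply, torusMean_apply, ← integral_comp_perm e g]
  simp only [h]

theorem torusMean_eq_of_halfShift {f g : C(Fin 3 → ℝ, ℝ)}
    (h : ∀ p, f p = g (fun i => halfShift (p i))) : torusMean f = torusMean g := by
  rw [torusMean_apply, torusMean_apply, ← integral_comp_halfShift g.continuous]
  simp only [h]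

/-- The function `p ↦ cos pᵢ`. -/
def cosCoord (i : Fin 3) : C(Fin 3 → ℝ, ℝ) := ⟨fun p => Real.cos (p i), continuous_cosCoord i⟩

theorem cosCoord_apply (i : Fin 3) (p : Fin 3 → ℝ) : cosCoord i p = Real.cos (p i) := rfl

theorem torusMean_cosCoord (i : Fin 3) : torusMean (cosCoord i) = 0 := by
  have h : torusMean (cosCoord i) = torusMean (-cosCoord i) :=
    torusMean_eq_of_halfShift fun p => by
      simp [cosCoord_apply, cos_halfShift]
  rw [map_neg] at h
  linarith

/-! ### The constants `a₁₁`, `a` and `μ₀` -/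

theorem sqrt_sq_mul (x y : ℝ) : (x / Real.sqrt (8 * Real.pi ^ 3)) ^ 2 / y =
    ((2 * Real.pi) ^ 3)⁻¹ * (x ^ 2 * y⁻¹) := by
  have hpi := Real.pi_pos
  rw [div_pow, Real.sq_sqrt (by positivity), mul_pow]
  norm_num
  ring

theorem dispersion_zero (p : Fin 3 → ℝ) : dispersion 0 p = edgeDispersion 1 p := by
  simp [dispersion, edgeDispersion]

theorem a11_eq : a11 = ((2 * Real.pi) ^ 3)⁻¹ * ∫ p, 1 * (edgeDispersion 1 p)⁻¹ ∂torusMeasure := by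
  rw [a11, ← integral_const_mul]
  simp only [sqrt_sq_mul, dispersion_zero, one_pow]

theorem aA12_eq : aA12 = ((2 * Real.pi) ^ 3)⁻¹ *
    ∫ p, (Real.cos (p 0) - Real.cos (p 1)) ^ 2 * (edgeDispersion 1 p)⁻¹ ∂torusMeasure := by
  rw [aA12, ← integral_const_mul]
  simp only [sqrt_sq_mul, dispersion_zero]

theorem cos_sub_sq_le (x y : ℝ) : |(Real.cos x - Real.cos y) ^ 2| ≤ 4 := by
  rw [abs_of_nonneg (sq_nonneg _)]
  have h1 := abs_le.1 (Real.abs_cos_le_one x)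
  have h2 := abs_le.1 (Real.abs_cos_le_one y)
  nlinarith

/-- Since `𝓔 ≤ 24`, the integrand dominates the continuous function `g/24`, whose integral is
positive. -/
theorem integral_mul_inv_edgeDispersion_pos {g : (Fin 3 → ℝ) → ℝ} (hg : Continuous g)
    (hg0 : ∀ p, 0 ≤ g p) {C : ℝ} (hC : ∀ p, |g p| ≤ C) {q : Fin 3 → ℝ}
    (hq : ∀ i, q i ∈ Set.Ioo (-Real.pi) Real.pi) (hgq : g q ≠ 0) :
    0 < ∫ p, g p * (edgeDispersion 1 p)⁻¹ ∂torusMeasure := by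
  have h := integral_torus_pos (hg.mul continuous_const) (g := fun p => g p * (24 : ℝ)⁻¹)
    (fun p => mul_nonneg (hg0 p) (by norm_num)) hq (by simpa using hgq)
  refine h.trans_le (integral_mono_ae
    (integrable_torus_of_continuous (hg.mul continuous_const))
    (integrable_mul_inv_edgeDispersion hg hC) ?_)
  filter_upwards [ae_edgeDispersion_pos] with p hp
  exact mul_le_mul_of_nonneg_left (inv_anti₀ hp (edgeDispersion_le (Or.inl rfl) p)) (hg0 p)

theorem aA12_pos : 0 < aA12 := by
  have hpi := Real.pi_pos
  rw [aA12_eq]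
  refine mul_pos (by positivity) (integral_mul_inv_edgeDispersion_pos (by fun_prop)
    (fun p => sq_nonneg _) (fun p => cos_sub_sq_le _ _) (q := ![0, Real.pi / 2, 0]) ?_ ?_)
  · intro i
    fin_cases i <;> simp [hpi]
    linarith
  · simp

/-- With `s = cos p₁ + cos p₂ + cos p₃`, the mean of `s²/𝓔` is positive and equals `9 a₁₁ - 3/4`.
The result makes `mu0` well defined and fixes the signs in the later parabola. -/
theorem one_lt_twelve_mul_a11 : 1 < 12 * a11 := by
  have hpi := Real.pi_pos
  have hs : ∀ p : Fin 3 → ℝ, |(Real.cos (p 0) + Real.cos (p 1) + Real.cos (p 2)) ^ 2| ≤ 9 := by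
    intro p
    rw [abs_of_nonneg (sq_nonneg _)]
    have h0 := abs_le.1 (Real.abs_cos_le_one (p 0))
    have h1 := abs_le.1 (Real.abs_cos_le_one (p 1))
    have h2 := abs_le.1 (Real.abs_cos_le_one (p 2))
    nlinarith
  have hpos := integral_mul_inv_edgeDispersion_pos (q := fun _ => 0)
    (g := fun p => (Real.cos (p 0) + Real.cos (p 1) + Real.cos (p 2)) ^ 2) (by fun_prop)
    (fun p => sq_nonneg _) hs (fun i => ⟨by linarith, hpi⟩) (by norm_num)
  -- This is the polynomial remainder in `s²/𝓔 = 9/𝓔 - k`, found by substituting `s = 3 - 𝓔/4`.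
  let k : C(Fin 3 → ℝ, ℝ) := (3 / 4 : ℝ) • 1 + (1 / 4 : ℝ) • (cosCoord 0 + cosCoord 1 + cosCoord 2)
  have hk : torusMean k = 3 / 4 := by
    simp only [k, map_add, map_smul, torusMean_one, torusMean_cosCoord]
    norm_num
  have he : ∫ p, (Real.cos (p 0) + Real.cos (p 1) + Real.cos (p 2)) ^ 2 *
      (edgeDispersion 1 p)⁻¹ ∂torusMeasure =
      9 * ∫ p, 1 * (edgeDispersion 1 p)⁻¹ ∂torusMeasure - ∫ p, k p ∂torusMeasure := by
    rw [← integral_const_mul, ← integral_sub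
      ((integrable_mul_inv_edgeDispersion continuous_const (C := 1) (by simp)).const_mul 9)
      (integrable_torus_of_continuous k.continuous)]
    refine integral_congr_ae ?_
    filter_upwards [ae_edgeDispersion_pos] with p hp
    have hk' : k p = 3 / 4 + 1 / 4 * (Real.cos (p 0) + Real.cos (p 1) + Real.cos (p 2)) := by
      simp [k, cosCoord_apply]
      ring
    rw [hk']
    have hE := edgeDispersion_eq 1 p
    have hs' : Real.cos (p 0) + Real.cos (p 1) + Real.cos (p 2) =
        3 - edgeDispersion 1 p / 4 := by linarith
    rw [hs']
    field_simp
    ring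
  rw [he] at hpos
  have h2 : 0 < ((2 * Real.pi) ^ 3)⁻¹ * (9 * ∫ p, 1 * (edgeDispersion 1 p)⁻¹ ∂torusMeasure -
    ∫ p, k p ∂torusMeasure) := mul_pos (by positivity) hpos
  rw [torusMean_apply] at hk
  rw [a11_eq]
  linarith

/-! ### The form in terms of means -/

/-- The function `edgeDispersion σ` as a continuous map. -/
def edgeMap (σ : ℝ) : C(Fin 3 → ℝ, ℝ) := ⟨edgeDispersion σ, continuous_edgeDispersion σ⟩

theorem edgeMap_apply (σ : ℝ) (p : Fin 3 → ℝ) : edgeMap σ p =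
    12 - 4 * σ * (Real.cos (p 0) + Real.cos (p 1) + Real.cos (p 2)) :=
  edgeDispersion_eq σ p

/-- The normalized form, in terms of means over the torus. -/
def meanForm (σ ν₁ ν₂ : ℝ) (F G : C(Fin 3 → ℝ, ℝ)) : ℝ :=
  torusMean (edgeMap σ * (F * G)) + ν₁ * (torusMean F * torusMean G) +
    2 * ν₂ * (torusMean (cosCoord 0 * F) * torusMean (cosCoord 0 * G) +
      torusMean (cosCoord 1 * F) * torusMean (cosCoord 1 * G) +
      torusMean (cosCoord 2 * F) * torusMean (cosCoord 2 * G))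

theorem meanForm_comm (σ ν₁ ν₂ : ℝ) (F G : C(Fin 3 → ℝ, ℝ)) :
    meanForm σ ν₁ ν₂ F G = meanForm σ ν₁ ν₂ G F := by
  rw [meanForm, meanForm, mul_comm F G]
  ring

/-- The sign is absorbed into the couplings, so one analysis in `ν = σμ` serves both edges. -/
theorem trialForm_eq (σ μ₁ μ₂ : ℝ) (F G : C(Fin 3 → ℝ, ℝ)) :
    trialForm σ μ₁ μ₂ F G = (2 * Real.pi) ^ 3 * meanForm σ (σ * μ₁) (σ * μ₂) F G := by
  have hpi := Real.pi_pos
  have h : ∀ f : C(Fin 3 → ℝ, ℝ), ∫ p, f p ∂torusMeasure = (2 * Real.pi) ^ 3 * torusMean f := by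
    intro f
    rw [torusMean_apply]
    field_simp
  have h0 : ∫ p, edgeDispersion σ p * (F p * G p) ∂torusMeasure =
      (2 * Real.pi) ^ 3 * torusMean (edgeMap σ * (F * G)) := h (edgeMap σ * (F * G))
  have hc : ∀ (i : Fin 3) (f : C(Fin 3 → ℝ, ℝ)), ∫ p, Real.cos (p i) * f p ∂torusMeasure =
      (2 * Real.pi) ^ 3 * torusMean (cosCoord i * f) := fun i f => h (cosCoord i * f)
  simp only [trialForm, meanForm, h0, h, hc, Fin.sum_univ_three]
  field_simp
  ring

/-! ### Trial functions -/

theorem IsTrial.add {f g : C(Fin 3 → ℝ, ℝ)} (hf : IsTrial f) (hg : IsTrial g) :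
    IsTrial (f + g : C(Fin 3 → ℝ, ℝ)) := by
  obtain ⟨C, hC⟩ := hf.bounded
  obtain ⟨D, hD⟩ := hg.bounded
  refine ⟨(f + g).continuous, ⟨C + D, fun p => ?_⟩, fun p => ?_⟩
  · exact (abs_add_le _ _).trans (add_le_add (hC p) (hD p))
  · simp only [ContinuousMap.add_apply, hf.even, hg.even]

theorem IsTrial.mul {f g : C(Fin 3 → ℝ, ℝ)} (hf : IsTrial f) (hg : IsTrial g) :
    IsTrial (f * g : C(Fin 3 → ℝ, ℝ)) := by
  obtain ⟨C, hC⟩ := hf.bounded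
  obtain ⟨D, hD⟩ := hg.bounded
  refine ⟨(f * g).continuous, ⟨C * D, fun p => ?_⟩, fun p => ?_⟩
  · rw [ContinuousMap.mul_apply, abs_mul]
    exact mul_le_mul (hC p) (hD p) (abs_nonneg _) ((abs_nonneg _).trans (hC p))
  · simp only [ContinuousMap.mul_apply, hf.even, hg.even]

theorem IsTrial.smul_one (x : ℝ) : IsTrial (x • 1 : C(Fin 3 → ℝ, ℝ)) :=
  ⟨ContinuousMap.continuous _, ⟨|x|, fun p => by simp⟩, fun p => by simp⟩

theorem IsTrial.sub {f g : C(Fin 3 → ℝ, ℝ)} (hf : IsTrial f) (hg : IsTrial g) :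
    IsTrial (f - g : C(Fin 3 → ℝ, ℝ)) := by
  have e : f - g = f + ((-1 : ℝ) • 1) * g := by
    ext p
    simp
    ring
  rw [e]
  exact hf.add ((IsTrial.smul_one _).mul hg)

theorem isTrial_cosCoord (i : Fin 3) : IsTrial (cosCoord i) :=
  ⟨ContinuousMap.continuous _, ⟨1, fun p => Real.abs_cos_le_one (p i)⟩, fun p => by
    simp [cosCoord_apply]⟩

/-! ### Regularized resolvent trial functions and their moments -/

section Resolvent

variable {σ ε : ℝ} (hσ : σ = 1 ∨ σ = -1) (hε : 0 < ε)

/-- The function `1 / (𝓔 + ε)`. -/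
def resMap : C(Fin 3 → ℝ, ℝ) :=
  ⟨fun p => (edgeDispersion σ p + ε)⁻¹, ((continuous_edgeDispersion σ).add_const ε).inv₀
    fun p => (add_pos_of_nonneg_of_pos (edgeDispersion_nonneg hσ p) hε).ne'⟩

theorem resMap_apply (p : Fin 3 → ℝ) :
    resMap hσ hε p = (edgeMap σ p + ε)⁻¹ := rfl

theorem resMap_pos (p : Fin 3 → ℝ) : 0 < resMap hσ hε p :=
  inv_pos.2 (add_pos_of_nonneg_of_pos (edgeDispersion_nonneg hσ p) hε)

theorem edgeMap_mul_resMap_apply (p : Fin 3 → ℝ) :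
    edgeMap σ p * resMap hσ hε p = 1 - ε * resMap hσ hε p := by
  have h : edgeMap σ p + ε ≠ 0 :=
    (add_pos_of_nonneg_of_pos (edgeDispersion_nonneg hσ p) hε).ne'
  rw [resMap_apply]
  field_simp
  ring

theorem isTrial_resMap : IsTrial (resMap hσ hε) := by
  refine ⟨ContinuousMap.continuous _, ⟨ε⁻¹, fun p => ?_⟩, fun p => ?_⟩
  · rw [abs_of_pos (resMap_pos hσ hε p)]
    exact inv_anti₀ hε (le_add_of_nonneg_left (edgeDispersion_nonneg hσ p))
  · simp [resMap_apply, edgeMap_apply]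

theorem edgeMap_perm (σ : ℝ) (e : Equiv.Perm (Fin 3)) (p : Fin 3 → ℝ) :
    edgeMap σ (fun i => p (e i)) = edgeMap σ p := by
  change 4 * ∑ i, (1 - σ * Real.cos (p (e i))) = 4 * ∑ i, (1 - σ * Real.cos (p i))
  rw [Equiv.sum_comp e (fun i => 1 - σ * Real.cos (p i))]

theorem resMap_perm (e : Equiv.Perm (Fin 3)) (p : Fin 3 → ℝ) :
    resMap hσ hε (fun i => p (e i)) = resMap hσ hε p := by
  rw [resMap_apply, resMap_apply, edgeMap_perm]

/-- Moments of order one and two of the coordinate cosines with respect to a permutation-invariant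
weight. -/
theorem torusMean_moments {w : C(Fin 3 → ℝ, ℝ)}
    (hw : ∀ (e : Equiv.Perm (Fin 3)) p, w (fun i => p (e i)) = w p) :
    (torusMean (cosCoord 1 * w) = torusMean (cosCoord 0 * w) ∧
      torusMean (cosCoord 2 * w) = torusMean (cosCoord 0 * w)) ∧
    (torusMean (cosCoord 1 * cosCoord 1 * w) = torusMean (cosCoord 0 * cosCoord 0 * w) ∧
      torusMean (cosCoord 2 * cosCoord 2 * w) = torusMean (cosCoord 0 * cosCoord 0 * w)) ∧
    torusMean (cosCoord 0 * cosCoord 2 * w) = torusMean (cosCoord 0 * cosCoord 1 * w) ∧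
      torusMean (cosCoord 1 * cosCoord 2 * w) = torusMean (cosCoord 0 * cosCoord 1 * w) := by
  refine ⟨⟨?_, ?_⟩, ⟨?_, ?_⟩, ?_, ?_⟩
  · refine torusMean_eq_of_perm (Equiv.swap 0 1) fun p => ?_
    simp [cosCoord_apply, hw]
  · refine torusMean_eq_of_perm (Equiv.swap 0 2) fun p => ?_
    simp [cosCoord_apply, hw]
  · refine torusMean_eq_of_perm (Equiv.swap 0 1) fun p => ?_
    simp [cosCoord_apply, hw]
  · refine torusMean_eq_of_perm (Equiv.swap 0 2) fun p => ?_
    simp [cosCoord_apply, hw]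
  · refine torusMean_eq_of_perm (Equiv.swap 1 2) fun p => ?_
    have h : Equiv.swap (1 : Fin 3) 2 0 = 0 := by decide
    simp [cosCoord_apply, hw, h]
  · refine torusMean_eq_of_perm (Equiv.swap 0 2) fun p => ?_
    have h : Equiv.swap (0 : Fin 3) 2 1 = 1 := by decide
    simp [cosCoord_apply, hw, h, mul_comm]

/-- The trial function `x + 1 / (𝓔 + ε)`. -/
def affTrial (x : ℝ) : C(Fin 3 → ℝ, ℝ) := x • 1 + resMap hσ hε

/-- The trial function `(cos p₁ - cos p₂) / (𝓔 + ε)`. -/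
def diffTrial : C(Fin 3 → ℝ, ℝ) := (cosCoord 0 - cosCoord 1) * resMap hσ hε

/-- The trial function `(cos p₁ + cos p₂ - 2 cos p₃) / (𝓔 + ε)`. -/
def diffTrial' : C(Fin 3 → ℝ, ℝ) :=
  ((cosCoord 0 - cosCoord 2) + (cosCoord 1 - cosCoord 2)) * resMap hσ hε

theorem isTrial_affTrial (x : ℝ) : IsTrial (affTrial hσ hε x) :=
  (IsTrial.smul_one x).add (isTrial_resMap hσ hε)

theorem isTrial_diffTrial : IsTrial (diffTrial hσ hε) :=
  ((isTrial_cosCoord 0).sub (isTrial_cosCoord 1)).mul (isTrial_resMap hσ hε)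

theorem isTrial_diffTrial' : IsTrial (diffTrial' hσ hε) :=
  (((isTrial_cosCoord 0).sub (isTrial_cosCoord 2)).add
    ((isTrial_cosCoord 1).sub (isTrial_cosCoord 2))).mul (isTrial_resMap hσ hε)

theorem torusMean_edgeMap (σ : ℝ) : torusMean (edgeMap σ) = 12 := by
  have e : edgeMap σ = (12 : ℝ) • 1 - (4 * σ) • (cosCoord 0 + cosCoord 1 + cosCoord 2) := by
    ext p
    simp [edgeMap_apply, cosCoord_apply]
    ring
  rw [e]
  simp only [map_sub, map_add, map_smul, torusMean_one, torusMean_cosCoord]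
  norm_num

theorem edgeMap_mul_resMap : edgeMap σ * resMap hσ hε = 1 - ε • resMap hσ hε := by
  ext p
  simpa using edgeMap_mul_resMap_apply hσ hε p

theorem torusMean_edge_res :
    torusMean (edgeMap σ * resMap hσ hε) = 1 - ε * torusMean (resMap hσ hε) := by
  rw [edgeMap_mul_resMap, map_sub, map_smul, torusMean_one, smul_eq_mul]

/-- By permutation symmetry the three cosine moments agree, so the mean of `𝓔/(𝓔 + ε)`, with `𝓔 = 12
- 4σ ∑ cos pᵢ`, determines each of them. -/
theorem torusMean_cosCoord_mul_res :
    12 * σ * torusMean (cosCoord 0 * resMap hσ hε) =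
      12 * torusMean (resMap hσ hε) - (1 - ε * torusMean (resMap hσ hε)) := by
  have h := torusMean_moments (resMap_perm hσ hε)
  have e : edgeMap σ * resMap hσ hε = (12 : ℝ) • resMap hσ hε - (4 * σ) •
      (cosCoord 0 * resMap hσ hε + cosCoord 1 * resMap hσ hε + cosCoord 2 * resMap hσ hε) := by
    ext p
    simp [edgeMap_apply, cosCoord_apply]
    ring
  rw [← torusMean_edge_res hσ hε, e]
  simp only [map_sub, map_add, map_smul, h.1.1, h.1.2, smul_eq_mul]
  ring

theorem sq_torusMean_cosCoord_mul_res :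
    144 * torusMean (cosCoord 0 * resMap hσ hε) ^ 2 =
      (12 * torusMean (resMap hσ hε) - 1 + ε * torusMean (resMap hσ hε)) ^ 2 := by
  have h := torusMean_cosCoord_mul_res hσ hε
  have hs : σ ^ 2 = 1 := by rcases hσ with rfl | rfl <;> norm_num
  calc 144 * torusMean (cosCoord 0 * resMap hσ hε) ^ 2
      = (12 * σ * torusMean (cosCoord 0 * resMap hσ hε)) ^ 2 := by
        linear_combination (-144 * torusMean (cosCoord 0 * resMap hσ hε) ^ 2) * hs
    _ = _ := by rw [h]; ring

/-- This is `𝓔/(𝓔 + ε) ≤ 1`, the only estimate made in evaluating the form on the trial functions.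
-/
theorem edgeMap_mul_sq_le (p : Fin 3 → ℝ) :
    (edgeMap σ * (resMap hσ hε * resMap hσ hε)) p ≤ resMap hσ hε p := by
  have h := edgeMap_mul_resMap_apply hσ hε p
  have hp := resMap_pos hσ hε p
  have e : (edgeMap σ * (resMap hσ hε * resMap hσ hε)) p =
      (edgeMap σ p * resMap hσ hε p) * resMap hσ hε p := by
    simp only [ContinuousMap.mul_apply]
    ring
  rw [e, h]
  nlinarith [mul_pos hε (mul_pos hp hp)]

theorem meanForm_one_one (σ ν₁ ν₂ : ℝ) : meanForm σ ν₁ ν₂ 1 1 = 12 + ν₁ := by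
  simp only [meanForm, mul_one, torusMean_one, torusMean_cosCoord, torusMean_edgeMap]
  ring

theorem torusMean_affTrial (x : ℝ) :
    torusMean (affTrial hσ hε x) = x + torusMean (resMap hσ hε) := by
  rw [affTrial, map_add, map_smul, torusMean_one, smul_eq_mul, mul_one]

theorem torusMean_cosCoord_mul_affTrial (x : ℝ) (i : Fin 3) :
    torusMean (cosCoord i * affTrial hσ hε x) = torusMean (cosCoord 0 * resMap hσ hε) := by
  have h := torusMean_moments (resMap_perm hσ hε)
  have e : cosCoord i * affTrial hσ hε x = x • cosCoord i + cosCoord i * resMap hσ hε := by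
    ext p
    simp [affTrial]
    ring
  rw [e, map_add, map_smul, torusMean_cosCoord, smul_zero, zero_add]
  fin_cases i
  · rfl
  · exact h.1.1
  · exact h.1.2

theorem meanForm_one_affTrial (ν₁ ν₂ x : ℝ) : meanForm σ ν₁ ν₂ 1 (affTrial hσ hε x) =
    12 * x + (1 - ε * torusMean (resMap hσ hε)) + ν₁ * (x + torusMean (resMap hσ hε)) := by
  have e : edgeMap σ * (1 * affTrial hσ hε x) = x • edgeMap σ + edgeMap σ * resMap hσ hε := by
    ext p
    simp [affTrial]
    ring
  simp only [meanForm, e, mul_one, map_add, map_smul, torusMean_edgeMap, torusMean_edge_res,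
    torusMean_one, torusMean_cosCoord, torusMean_affTrial, smul_eq_mul]
  ring

/-- Only the mean of `𝓔/(𝓔 + ε)²` is estimated; the interaction is computed exactly, so the bound
holds for couplings of either sign. -/
theorem meanForm_affTrial_le (ν₁ ν₂ x : ℝ) :
    meanForm σ ν₁ ν₂ (affTrial hσ hε x) (affTrial hσ hε x) ≤
      12 * x ^ 2 + 2 * x * (1 - ε * torusMean (resMap hσ hε)) + torusMean (resMap hσ hε) +
        ν₁ * (x + torusMean (resMap hσ hε)) ^ 2 +
        ν₂ * (12 * torusMean (resMap hσ hε) - 1 + ε * torusMean (resMap hσ hε)) ^ 2 / 24 := by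
  have e : edgeMap σ * (affTrial hσ hε x * affTrial hσ hε x) = (x ^ 2) • edgeMap σ +
      (2 * x) • (edgeMap σ * resMap hσ hε) +
        edgeMap σ * (resMap hσ hε * resMap hσ hε) := by
    ext p
    simp [affTrial]
    ring
  have h1 := torusMean_mono (edgeMap_mul_sq_le hσ hε)
  rw [← sq_torusMean_cosCoord_mul_res hσ hε]
  simp only [meanForm, e, map_add, map_smul, torusMean_edgeMap, torusMean_edge_res,
    torusMean_affTrial, torusMean_cosCoord_mul_affTrial, smul_eq_mul]
  linarith

/-! ### Orthogonality and form bounds for the non-symmetric trial functions -/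

theorem mul_perm {f g : C(Fin 3 → ℝ, ℝ)}
    (hf : ∀ (e : Equiv.Perm (Fin 3)) p, f (fun i => p (e i)) = f p)
    (hg : ∀ (e : Equiv.Perm (Fin 3)) p, g (fun i => p (e i)) = g p)
    (e : Equiv.Perm (Fin 3)) (p : Fin 3 → ℝ) : (f * g) (fun i => p (e i)) = (f * g) p := by
  simp only [ContinuousMap.mul_apply, hf, hg]

theorem torusMean_diff_mul {w : C(Fin 3 → ℝ, ℝ)}
    (hw : ∀ (e : Equiv.Perm (Fin 3)) p, w (fun i => p (e i)) = w p) :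
    torusMean ((cosCoord 0 - cosCoord 1) * w) = 0 ∧
      torusMean (((cosCoord 0 - cosCoord 2) + (cosCoord 1 - cosCoord 2)) * w) = 0 := by
  obtain ⟨⟨h1, h2⟩, -⟩ := torusMean_moments hw
  simp only [add_mul, sub_mul, map_sub, map_add, h1, h2]
  constructor <;> ring

/-- A permutation-invariant weight gives a second-moment matrix with equal diagonal and equal
off-diagonal entries. On vectors of coordinate sum zero, such as `(1, -1, 0)` and `(1, 1, -2)`, it
acts as multiplication by the difference `D`. -/
theorem torusMean_diff_mul_diff {w : C(Fin 3 → ℝ, ℝ)}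
    (hw : ∀ (e : Equiv.Perm (Fin 3)) p, w (fun i => p (e i)) = w p) {D : ℝ}
    (hD : D = torusMean (cosCoord 0 * cosCoord 0 * w) - torusMean (cosCoord 0 * cosCoord 1 * w)) :
    (torusMean (cosCoord 0 * ((cosCoord 0 - cosCoord 1) * w)) = D ∧
      torusMean (cosCoord 1 * ((cosCoord 0 - cosCoord 1) * w)) = -D ∧
      torusMean (cosCoord 2 * ((cosCoord 0 - cosCoord 1) * w)) = 0) ∧
    (torusMean (cosCoord 0 * (((cosCoord 0 - cosCoord 2) + (cosCoord 1 - cosCoord 2)) * w)) = D ∧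
      torusMean (cosCoord 1 * (((cosCoord 0 - cosCoord 2) + (cosCoord 1 - cosCoord 2)) * w)) = D ∧
      torusMean (cosCoord 2 * (((cosCoord 0 - cosCoord 2) + (cosCoord 1 - cosCoord 2)) * w)) =
        -2 * D) := by
  obtain ⟨-, ⟨h3, h4⟩, h5, h6⟩ := torusMean_moments hw
  have c10 : cosCoord 1 * (cosCoord 0 * w) = cosCoord 0 * (cosCoord 1 * w) := by ring
  have c20 : cosCoord 2 * (cosCoord 0 * w) = cosCoord 0 * (cosCoord 2 * w) := by ring
  have c21 : cosCoord 2 * (cosCoord 1 * w) = cosCoord 1 * (cosCoord 2 * w) := by ring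
  simp only [mul_assoc] at h3 h4 h5 h6 hD
  simp only [add_mul, sub_mul, mul_add, mul_sub, map_sub, map_add, c10, c20, c21, h3, h4, h5, h6,
    hD]
  refine ⟨⟨trivial, ?_, ?_⟩, ?_, ?_, ?_⟩ <;> ring

/-- The permutation-invariant trial functions and the antisymmetric ones are
orthogonal. -/
theorem meanForm_affTrial_diffTrial (ν₁ ν₂ x : ℝ) :
    meanForm σ ν₁ ν₂ (affTrial hσ hε x) (diffTrial hσ hε) = 0 ∧
      meanForm σ ν₁ ν₂ (affTrial hσ hε x) (diffTrial' hσ hε) = 0 := by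
  have hh := resMap_perm hσ hε
  have hE := edgeMap_perm σ
  have haff : ∀ (e : Equiv.Perm (Fin 3)) p, affTrial hσ hε x (fun i => p (e i)) =
      affTrial hσ hε x p := by
    intro e p
    simp [affTrial, hh]
  have hd := torusMean_diff_mul hh
  have hw := torusMean_diff_mul (mul_perm (mul_perm hE haff) hh)
  have hD := torusMean_diff_mul_diff hh rfl
  have e : ∀ f : C(Fin 3 → ℝ, ℝ), edgeMap σ * (affTrial hσ hε x * (f * resMap hσ hε)) =
      f * (edgeMap σ * affTrial hσ hε x * resMap hσ hε) := fun f => by ring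
  constructor
  · simp only [meanForm, diffTrial, e, hw.1, hd.1, torusMean_cosCoord_mul_affTrial, hD.1.1,
      hD.1.2.1, hD.1.2.2]
    ring
  · simp only [meanForm, diffTrial', e, hw.2, hd.2, torusMean_cosCoord_mul_affTrial, hD.2.1,
      hD.2.2.1, hD.2.2.2]
    ring

theorem torusMean_diff_sq_mul {w : C(Fin 3 → ℝ, ℝ)}
    (hw : ∀ (e : Equiv.Perm (Fin 3)) p, w (fun i => p (e i)) = w p) :
    torusMean ((cosCoord 0 - cosCoord 1) ^ 2 * w) = 2 *
      (torusMean (cosCoord 0 * cosCoord 0 * w) - torusMean (cosCoord 0 * cosCoord 1 * w)) := by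
  have hD := (torusMean_diff_mul_diff hw rfl).1
  have e : (cosCoord 0 - cosCoord 1) ^ 2 * w = cosCoord 0 * ((cosCoord 0 - cosCoord 1) * w) -
      cosCoord 1 * ((cosCoord 0 - cosCoord 1) * w) := by ring
  rw [e, map_sub, hD.1, hD.2.1]
  ring

/-- Here `a = 2D`. The kinetic part is at most `a` and the `ν₂` part is exactly `ν₂ a²`. The second
function picks up the factor `3 = |(1, 1, -2)|² / |(1, -1, 0)|²`, while the `ν₁` part vanishes
because both functions have mean zero. -/
theorem meanForm_diffTrial (ν₁ ν₂ : ℝ) {a : ℝ}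
    (ha : a = torusMean ((cosCoord 0 - cosCoord 1) ^ 2 * resMap hσ hε)) :
    meanForm σ ν₁ ν₂ (diffTrial hσ hε) (diffTrial' hσ hε) = 0 ∧
    meanForm σ ν₁ ν₂ (diffTrial hσ hε) (diffTrial hσ hε) ≤ a * (1 + ν₂ * a) ∧
    meanForm σ ν₁ ν₂ (diffTrial' hσ hε) (diffTrial' hσ hε) ≤ 3 * (a * (1 + ν₂ * a)) := by
  have hh := resMap_perm hσ hε
  have hE := edgeMap_perm σ
  have hW := mul_perm hE (mul_perm hh hh)
  set h := resMap hσ hε with hh_def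
  set W := edgeMap σ * (h * h) with hW_def
  have hd := torusMean_diff_mul hh
  have hD := torusMean_diff_mul_diff hh rfl
  have hD' := torusMean_diff_mul_diff hW rfl
  have hle : torusMean ((cosCoord 0 - cosCoord 1) ^ 2 * W) ≤ a := by
    rw [ha]
    exact torusMean_mono fun p => mul_le_mul_of_nonneg_left (edgeMap_mul_sq_le hσ hε p)
      (sq_nonneg ((cosCoord 0 - cosCoord 1) p))
  rw [torusMean_diff_sq_mul hW] at hle
  rw [torusMean_diff_sq_mul hh] at ha
  set D := torusMean (cosCoord 0 * cosCoord 0 * h) - torusMean (cosCoord 0 * cosCoord 1 * h)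
  set D' := torusMean (cosCoord 0 * cosCoord 0 * W) - torusMean (cosCoord 0 * cosCoord 1 * W)
  have e11 : edgeMap σ * (((cosCoord 0 - cosCoord 1) * h) * ((cosCoord 0 - cosCoord 1) * h)) =
      cosCoord 0 * ((cosCoord 0 - cosCoord 1) * W) -
        cosCoord 1 * ((cosCoord 0 - cosCoord 1) * W) := by
    rw [hW_def]
    ring
  have e12 : edgeMap σ * (((cosCoord 0 - cosCoord 1) * h) *
      (((cosCoord 0 - cosCoord 2) + (cosCoord 1 - cosCoord 2)) * h)) =
      cosCoord 0 * (((cosCoord 0 - cosCoord 2) + (cosCoord 1 - cosCoord 2)) * W) -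
        cosCoord 1 * (((cosCoord 0 - cosCoord 2) + (cosCoord 1 - cosCoord 2)) * W) := by
    rw [hW_def]
    ring
  have e22 : edgeMap σ * ((((cosCoord 0 - cosCoord 2) + (cosCoord 1 - cosCoord 2)) * h) *
      (((cosCoord 0 - cosCoord 2) + (cosCoord 1 - cosCoord 2)) * h)) =
      cosCoord 0 * (((cosCoord 0 - cosCoord 2) + (cosCoord 1 - cosCoord 2)) * W) +
        cosCoord 1 * (((cosCoord 0 - cosCoord 2) + (cosCoord 1 - cosCoord 2)) * W) -
        (cosCoord 2 * (((cosCoord 0 - cosCoord 2) + (cosCoord 1 - cosCoord 2)) * W) +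
        cosCoord 2 * (((cosCoord 0 - cosCoord 2) + (cosCoord 1 - cosCoord 2)) * W)) := by
    rw [hW_def]
    ring
  simp only [meanForm, diffTrial, diffTrial', ← hh_def, e11, e12, e22, map_sub, map_add, hd.1,
    hd.2, hD.1.1, hD.1.2.1, hD.1.2.2, hD.2.1, hD.2.2.1, hD.2.2.2, hD'.1.1, hD'.1.2.1, hD'.2.1,
    hD'.2.2.1, hD'.2.2.2]
  refine ⟨by ring, ?_, ?_⟩
  · rw [ha] at hle ⊢
    linarith
  · rw [ha] at hle ⊢
    linarith

/-- Shifting every momentum by `π` flips all cosines, so the mean at the upper edge equals the mean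
at the lower one. -/
theorem torusMean_resMap : torusMean (resMap hσ hε) =
    ((2 * Real.pi) ^ 3)⁻¹ * ∫ p, 1 * (edgeDispersion 1 p + ε)⁻¹ ∂torusMeasure := by
  have h1 : torusMean (resMap (Or.inl rfl : (1 : ℝ) = 1 ∨ (1 : ℝ) = -1) hε) =
      ((2 * Real.pi) ^ 3)⁻¹ * ∫ p, 1 * (edgeDispersion 1 p + ε)⁻¹ ∂torusMeasure := by
    simp only [one_mul]
    rfl
  rw [← h1]
  rcases hσ with rfl | rfl
  · rfl
  · refine torusMean_eq_of_halfShift fun p => ?_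
    simp only [resMap_apply, edgeMap_apply, cos_halfShift]
    ring

theorem torusMean_diff_sq_mul_resMap :
    torusMean ((cosCoord 0 - cosCoord 1) ^ 2 * resMap hσ hε) = ((2 * Real.pi) ^ 3)⁻¹ *
      ∫ p, (Real.cos (p 0) - Real.cos (p 1)) ^ 2 * (edgeDispersion 1 p + ε)⁻¹ ∂torusMeasure := by
  have h1 : torusMean ((cosCoord 0 - cosCoord 1) ^ 2 *
      resMap (Or.inl rfl : (1 : ℝ) = 1 ∨ (1 : ℝ) = -1) hε) = ((2 * Real.pi) ^ 3)⁻¹ *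
      ∫ p, (Real.cos (p 0) - Real.cos (p 1)) ^ 2 * (edgeDispersion 1 p + ε)⁻¹ ∂torusMeasure := rfl
  rw [← h1]
  rcases hσ with rfl | rfl
  · rfl
  · refine torusMean_eq_of_halfShift fun p => ?_
    simp only [ContinuousMap.mul_apply, ContinuousMap.pow_apply, ContinuousMap.sub_apply,
      cosCoord_apply, resMap_apply, edgeMap_apply, cos_halfShift]
    ring

end Resolvent

/-! ### Negative directions in the regions of the coupling plane -/

/-- Upper bound for the form at `x + 1 / (𝓔 + ε)`, where `J` is the mean of `1 / (𝓔 + ε)`. -/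
def affBound (ν₁ ν₂ : ℝ) (q : ℝ × ℝ × ℝ) : ℝ :=
  12 * q.1 ^ 2 + 2 * q.1 * (1 - q.2.1 * q.2.2) + q.2.2 + ν₁ * (q.1 + q.2.2) ^ 2 +
    ν₂ * (12 * q.2.2 - 1 + q.2.1 * q.2.2) ^ 2 / 24

theorem continuous_affBound (ν₁ ν₂ : ℝ) : Continuous (affBound ν₁ ν₂) := by
  unfold affBound
  fun_prop

/-- The variable `u = x + a₁₁` is the mean of the limiting trial function, so `ν₁` appears only in
the coefficient of `u²`; the remaining constant is what `mu0` records. -/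
theorem affBound_zero (ν₁ ν₂ u : ℝ) : affBound ν₁ ν₂ (u - a11, 0, a11) =
    (12 + ν₁) * u ^ 2 - 2 * (12 * a11 - 1) * u + (12 * a11 - 1) ^ 2 / 24 * (ν₂ + mu0) := by
  have h := one_lt_twelve_mul_a11
  have h' : 12 * a11 - 1 ≠ 0 := by linarith
  rw [affBound, mu0]
  field_simp
  ring

/-- The critical value of the parabola, a minimum for `ν₁ > -12` and a maximum for `ν₁ < -12`. Its
sign explains the curve `mu2Minus`. -/
theorem affBound_zero_crit {ν₁ : ℝ} (hν : ν₁ ≠ -12) (ν₂ : ℝ) :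
    affBound ν₁ ν₂ ((12 * a11 - 1) / (ν₁ + 12) - a11, 0, a11) =
      (12 * a11 - 1) ^ 2 / 24 * (ν₂ - mu2Minus ν₁) := by
  have h : ν₁ + 12 ≠ 0 := fun h => hν (by linarith)
  rw [affBound_zero, mu2Minus]
  field_simp
  ring

theorem exists_affBound_neg_of_mem_AMinus_one {ν₁ ν₂ : ℝ} (h : (ν₁, ν₂) ∈ AMinus 1) :
    ∃ x, affBound ν₁ ν₂ (x, 0, a11) < 0 := by
  have hA := one_lt_twelve_mul_a11
  have hw : 0 < 12 * a11 - 1 := by linarith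
  rcases lt_or_ge (-12) ν₁ with hν | hν
  · refine ⟨_, (affBound_zero_crit hν.ne' ν₂).trans_lt ?_⟩
    have h2 : ν₂ < mu2Minus ν₁ := by
      rcases h with (⟨-, h⟩ | h) | ⟨h, -⟩
      · exact h
      · exact absurd h hν.ne'
      · exact absurd h hν.not_gt
    exact mul_neg_of_pos_of_neg (by positivity) (by linarith)
  -- For `ν₁ ≤ -12` the quadratic term is nonpositive and the linear term has negative slope, so a
  -- large `u` suffices; this one makes the linear term outweigh the constant `κ` by `1`.
  · set κ := (12 * a11 - 1) ^ 2 / 24 * (ν₂ + mu0) with hκ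
    set u := (|κ| + 1) / (2 * (12 * a11 - 1)) with hu
    refine ⟨u - a11, ?_⟩
    rw [affBound_zero, ← hκ]
    have h1 : 2 * (12 * a11 - 1) * u = |κ| + 1 := by
      rw [hu]
      field_simp
    have h2 : (12 + ν₁) * u ^ 2 ≤ 0 :=
      mul_nonpos_of_nonpos_of_nonneg (by linarith) (sq_nonneg u)
    linarith [le_abs_self κ]

/-- The mean of `1 / (𝓔 + ε)`. -/
def resMean (ε : ℝ) : ℝ :=
  ((2 * Real.pi) ^ 3)⁻¹ * ∫ p, 1 * (edgeDispersion 1 p + ε)⁻¹ ∂torusMeasure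

/-- The mean of `(cos p₁ - cos p₂)² / (𝓔 + ε)`. -/
def diffMean (ε : ℝ) : ℝ := ((2 * Real.pi) ^ 3)⁻¹ *
  ∫ p, (Real.cos (p 0) - Real.cos (p 1)) ^ 2 * (edgeDispersion 1 p + ε)⁻¹ ∂torusMeasure

theorem tendsto_resMean : Tendsto resMean (𝓝[>] 0) (𝓝 a11) := by
  rw [a11_eq]
  exact (tendsto_integral_mul_inv_edgeDispersion continuous_const (C := 1) (by simp)).const_mul _

theorem tendsto_diffMean : Tendsto diffMean (𝓝[>] 0) (𝓝 aA12) := by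
  rw [aA12_eq]
  exact (tendsto_integral_mul_inv_edgeDispersion (by fun_prop)
    (fun p => cos_sub_sq_le _ _)).const_mul _

theorem tendsto_affBound {ν₁ ν₂ x : ℝ} {f : ℝ → ℝ} (hf : Tendsto f (𝓝[>] 0) (𝓝 x)) :
    Tendsto (fun ε => affBound ν₁ ν₂ (f ε, ε, resMean ε)) (𝓝[>] 0)
      (𝓝 (affBound ν₁ ν₂ (x, 0, a11))) :=
  ((continuous_affBound ν₁ ν₂).tendsto _).comp (hf.prodMk_nhds
    ((tendsto_id.mono_left nhdsWithin_le_nhds).prodMk_nhds tendsto_resMean))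

theorem meanForm_affTrial_le_affBound {σ ε : ℝ} (hσ : σ = 1 ∨ σ = -1) (hε : 0 < ε)
    (ν₁ ν₂ x : ℝ) : meanForm σ ν₁ ν₂ (affTrial hσ hε x) (affTrial hσ hε x) ≤
      affBound ν₁ ν₂ (x, ε, resMean ε) := by
  have h := meanForm_affTrial_le hσ hε ν₁ ν₂ x
  rwa [torusMean_resMap] at h

/-- In the region `𝒟⁻_α` there are `α` trial functions on which the form is diagonal and
negative. -/
theorem exists_trial_of_mem_DMinus {σ : ℝ} (hσ : σ = 1 ∨ σ = -1) {ν₁ ν₂ : ℝ} {α : ℕ}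
    (h : (ν₁, ν₂) ∈ DMinus α) : ∃ F : Fin α → C(Fin 3 → ℝ, ℝ), (∀ i, IsTrial (F i)) ∧
      (∀ i j, i < j → meanForm σ ν₁ ν₂ (F i) (F j) = 0) ∧
      ∀ i, meanForm σ ν₁ ν₂ (F i) (F i) < 0 := by
  match α, h with
  | 0, _ => exact ⟨fun _ => 0, fun i => i.elim0, fun i => i.elim0, fun i => i.elim0⟩
  | 1, h =>
    obtain ⟨x, hx⟩ := exists_affBound_neg_of_mem_AMinus_one h.1
    -- Negativity of the limiting bound persists for small `ε > 0`, where the trial function is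
    -- admissible.
    obtain ⟨ε, hε', hε⟩ := ((tendsto_affBound (tendsto_const_nhds (x := x))).eventually_lt_const
      hx |>.and self_mem_nhdsWithin).exists
    refine ⟨fun _ => affTrial hσ hε x, fun _ => isTrial_affTrial hσ hε x, fun i j hij => ?_,
      fun _ => (meanForm_affTrial_le_affBound hσ hε ν₁ ν₂ x).trans_lt hε'⟩
    exact absurd hij (by omega)
  | 2, h =>
    obtain ⟨h1, h2⟩ : ν₁ < -12 ∧ ν₂ < mu2Minus ν₁ := h
    have hb : ν₁ + 12 ≠ 0 := by linarith
    have hA := one_lt_twelve_mul_a11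
    have hw : 0 < 12 * a11 - 1 := by linarith
    -- The root in `x` of `meanForm_one_affTrial`, making the trial function form-orthogonal to the
    -- constant `1`. As `ε → 0` it tends to the critical point of the parabola, whose value is
    -- negative in this region.
    set f : ℝ → ℝ := fun ε => -(1 - ε * resMean ε + ν₁ * resMean ε) / (ν₁ + 12) with hf
    have hlim : Tendsto f (𝓝[>] 0) (𝓝 ((12 * a11 - 1) / (ν₁ + 12) - a11)) := by
      have hid : Tendsto (fun ε : ℝ => ε) (𝓝[>] 0) (𝓝 0) :=
        tendsto_id.mono_left nhdsWithin_le_nhds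
      have h3 := (((hid.mul tendsto_resMean).const_sub 1).add
        (tendsto_resMean.const_mul ν₁)).neg.div_const (ν₁ + 12)
      have e : (12 * a11 - 1) / (ν₁ + 12) - a11 = -(1 - 0 * a11 + ν₁ * a11) / (ν₁ + 12) := by
        field_simp
        ring
      rw [e]
      exact h3
    have hneg : affBound ν₁ ν₂ ((12 * a11 - 1) / (ν₁ + 12) - a11, 0, a11) < 0 := by
      rw [affBound_zero_crit h1.ne]
      exact mul_neg_of_pos_of_neg (by positivity) (by linarith)
    obtain ⟨ε, hε', hε⟩ := ((tendsto_affBound hlim).eventually_lt_const hneg |>.and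
      self_mem_nhdsWithin).exists
    refine ⟨![1, affTrial hσ hε (f ε)], ?_, ?_, ?_⟩
    · intro i
      fin_cases i
      · have := IsTrial.smul_one 1
        rwa [one_smul] at this
      · exact isTrial_affTrial hσ hε (f ε)
    · intro i j hij
      have h01 : meanForm σ ν₁ ν₂ 1 (affTrial hσ hε (f ε)) = 0 := by
        rw [meanForm_one_affTrial, torusMean_resMap, ← resMean, hf]
        field_simp
        ring
      fin_cases i <;> fin_cases j <;> first | exact h01 | exact absurd hij (by decide)
    · intro i
      fin_cases i
      · exact (meanForm_one_one σ ν₁ ν₂).trans_lt (by linarith)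
      · exact (meanForm_affTrial_le_affBound hσ hε ν₁ ν₂ _).trans_lt hε'
  | 3, h =>
    obtain ⟨hA1, -, hB⟩ := h
    obtain ⟨x, hx⟩ := exists_affBound_neg_of_mem_AMinus_one hA1
    have ha := aA12_pos
    -- This is the limiting factor in the bound of `meanForm_diffTrial`. A single small `ε` must
    -- then keep it, `diffMean` and the affine bound on the right side of zero.
    have hB' : 1 + ν₂ * aA12 < 0 := by
      have h1 : ν₂ < -(1 / aA12) := hB
      have h2 := mul_lt_mul_of_pos_right h1 ha
      have h3 : -(1 / aA12) * aA12 = -1 := by field_simp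
      linarith
    obtain ⟨ε, ⟨⟨hε', ha'⟩, hB''⟩, hε⟩ :=
      ((((tendsto_affBound (tendsto_const_nhds (x := x))).eventually_lt_const hx).and
        (tendsto_diffMean.eventually_const_lt ha)).and
        ((tendsto_diffMean.const_mul ν₂).const_add 1 |>.eventually_lt_const hB') |>.and
        self_mem_nhdsWithin).exists
    have hneg : diffMean ε * (1 + ν₂ * diffMean ε) < 0 := mul_neg_of_pos_of_neg ha' hB''
    have hd := meanForm_diffTrial hσ hε ν₁ ν₂ (torusMean_diff_sq_mul_resMap hσ hε).symm
    have had := meanForm_affTrial_diffTrial hσ hε ν₁ ν₂ x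
    rw [← diffMean] at hd
    refine ⟨![affTrial hσ hε x, diffTrial hσ hε, diffTrial' hσ hε], ?_, ?_, ?_⟩
    · intro i
      fin_cases i
      · exact isTrial_affTrial hσ hε x
      · exact isTrial_diffTrial hσ hε
      · exact isTrial_diffTrial' hσ hε
    · intro i j hij
      fin_cases i <;> fin_cases j <;>
        first | exact had.1 | exact had.2 | exact hd.1 | exact absurd hij (by decide)
    · intro i
      fin_cases i
      · exact (meanForm_affTrial_le_affBound hσ hε ν₁ ν₂ x).trans_lt hε'
      · exact hd.2.1.trans_lt hneg
      · exact hd.2.2.trans_lt (by linarith)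
  | n + 4, h => exact h.elim

/-! ### From regions of couplings to eigenvalue counts -/

theorem hasAtLeastEigenvaluesBelow_of_mem_DMinus {σ : ℝ} (hσ : σ = 1 ∨ σ = -1) {μ₁ μ₂ : ℝ} {α : ℕ}
    (h : (σ * μ₁, σ * μ₂) ∈ DMinus α) {K : Fin 3 → ℝ} (hK : ∀ i, 0 ≤ Real.cos (K i / 2)) :
    HasAtLeastEigenvaluesBelow ((σ : ℂ) • hamiltonian μ₁ μ₂ K) α := by
  have hpi := Real.pi_pos
  obtain ⟨F, hF, hoff, hdiag⟩ := exists_trial_of_mem_DMinus hσ h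
  refine hasAtLeastEigenvaluesBelow_of_trial hσ μ₁ μ₂ hK (fun i => F i) hF ?_ ?_
  · intro i j hij
    rw [trialForm_eq]
    rcases lt_or_gt_of_ne hij with hlt | hlt
    · rw [hoff i j hlt, mul_zero]
    · rw [meanForm_comm, hoff j i hlt, mul_zero]
  · intro i
    rw [trialForm_eq]
    exact mul_neg_of_pos_of_neg (by positivity) (hdiag i)

/-- The regions for the two edges are mirror images in the origin, because `mu2Minus (-μ₁) =
-mu2Plus μ₁`. -/
theorem neg_mem_DMinus_of_mem_DPlus {μ₁ μ₂ : ℝ} {β : ℕ} (h : (μ₁, μ₂) ∈ DPlus β) :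
    (-1 * μ₁, -1 * μ₂) ∈ DMinus β := by
  have e : mu2Minus (-1 * μ₁) = -mu2Plus μ₁ := by
    have : -1 * μ₁ + 12 = -(μ₁ - 12) := by ring
    rw [mu2Minus, mu2Plus, this, div_neg]
    ring
  have hA0 : (μ₁, μ₂) ∈ APlus 0 → (-1 * μ₁, -1 * μ₂) ∈ AMinus 0 := by
    rintro ⟨h1, h2⟩
    exact ⟨by linarith, by change mu2Minus (-1 * μ₁) < -1 * μ₂; linarith⟩
  have hA2 : (μ₁, μ₂) ∈ APlus 2 → (-1 * μ₁, -1 * μ₂) ∈ AMinus 2 := by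
    rintro ⟨h1, h2⟩
    exact ⟨by change -1 * μ₁ < -12; linarith, by change -1 * μ₂ < mu2Minus (-1 * μ₁); linarith⟩
  have hA1 : (μ₁, μ₂) ∈ APlus 1 → (-1 * μ₁, -1 * μ₂) ∈ AMinus 1 := by
    rintro ((⟨h1, h2⟩ | h1) | ⟨h1, h2⟩)
    · exact Or.inl (Or.inl ⟨by linarith, by change -1 * μ₂ < mu2Minus (-1 * μ₁); linarith⟩)
    · have h1' : μ₁ = 12 := h1
      exact Or.inl (Or.inr (by change -1 * μ₁ = -12; linarith))
    · exact Or.inr ⟨by change -1 * μ₁ < -12; linarith,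
        by change mu2Minus (-1 * μ₁) < -1 * μ₂; linarith⟩
  match β, h with
  | 0, h => exact hA0 h
  | 1, ⟨h, hn⟩ =>
    refine ⟨hA1 h, fun hc => hn ⟨h, ?_⟩⟩
    obtain ⟨-, h1, h2⟩ := hc
    have h1' : -1 * μ₁ = 0 := h1
    have h2' : -1 * μ₂ < -mu2crit := h2
    exact ⟨by linarith, by change mu2crit < μ₂; linarith⟩
  | 2, h => exact hA2 h
  | 3, ⟨h, h1, h2⟩ =>
    have h1' : μ₁ = 0 := h1
    have h2' : mu2crit < μ₂ := h2
    exact ⟨hA1 h, by change -1 * μ₁ = 0; linarith, by change -1 * μ₂ < -mu2crit; linarith⟩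
  | n + 4, h => exact h.elim

end TwoBoson

end

theorem theorem4p9 (μ₁ μ₂ : ℝ) (α β : ℕ) (hα : α ≤ 3) (hβ : β ≤ 3)
    (hαβ : α + β < 3 ∨ (α, β) = (3, 0) ∨ (α, β) = (0, 3))
    (hG : (μ₁, μ₂) ∈ TwoBoson.G α β)
    (K : Fin 3 → ℝ) (hK : K ∈ TwoBoson.torus) :
    TwoBoson.HasAtLeastEigenvaluesBelow (TwoBoson.hamiltonian μ₁ μ₂ K) α ∧
      TwoBoson.HasAtLeastEigenvaluesAbove (TwoBoson.hamiltonian μ₁ μ₂ K) β := by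
  -- The representative in `[-π, π)` matters: it puts `Kᵢ/2` in `[-π/2, π/2)`, where the cosine is
  -- nonnegative.
  have hcos : ∀ i, 0 ≤ Real.cos (K i / 2) := fun i =>
    Real.cos_nonneg_of_mem_Icc
      ⟨by linarith [(hK i trivial).1], by linarith [(hK i trivial).2]⟩
  constructor
  · have h := TwoBoson.hasAtLeastEigenvaluesBelow_of_mem_DMinus (Or.inl rfl) (μ₁ := μ₁) (μ₂ := μ₂)
      (by simpa only [one_mul] using hG.1) hcos
    simpa using h
  · have h := TwoBoson.hasAtLeastEigenvaluesBelow_of_mem_DMinus (Or.inr rfl)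
      (TwoBoson.neg_mem_DMinus_of_mem_DPlus hG.2) hcos
    have e : ((-1 : ℝ) : ℂ) • TwoBoson.hamiltonian μ₁ μ₂ K = -TwoBoson.hamiltonian μ₁ μ₂ K := by
      refine ContinuousLinearMap.ext fun f => ?_
      change ((-1 : ℝ) : ℂ) • TwoBoson.hamiltonian μ₁ μ₂ K f = -TwoBoson.hamiltonian μ₁ μ₂ K f
      rw [Complex.ofReal_neg, Complex.ofReal_one]
      exact neg_one_smul ℂ _
    exact TwoBoson.HasAtLeastEigenvaluesBelow.above_of_neg (e ▸ h)
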